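/- Setting. Let $(X,d)$ be a separable metric space and $\mu$ a $\sigma$-finite Borel measure on $X$. $\operatorname{Lip}(X)$ and $\operatorname{Lip}_b(X)$ denote the real Lipschitz, respectively bounded Lipschitz, functions, and $\|f\|_{\operatorname{Lip}}=\max\{L(f),\|f\|_\infty\}$, where $L(f)$ is the Lipschitz constant. For $S\subseteq X$, $f_k\stackrel{*}{\rightharpoonup}f$ in $\operatorname{Lip}_b(S)$ means $f_k\to f$ pointwise on $S$ and $\sup_k\|f_k|_S\|_{\operatorname{Lip}}<\infty$. Put $\operatorname{Lip}[f](x)=\limsup_{r\to0}\sup_{y\in\bar B(x,r)}|f(y)-f(x)|/r$. A *derivation* is a bounded linear map $\delta:\operatorname{Lip}_b(X)\to L^\infty(X;\mu)$ with $\delta(fg)=f\,\delta g+g\,\delta f$ and such that $f_k\stackrel{*}{\rightharpoonup}f$ in $\operatorname{Lip}_b(X)$ implies $\delta f_k\stackrel{*}{\rightharpoonup}\delta f$ in $L^\infty=(L^1)^*$; $\Upsilon(X,\mu)$ is the set of derivations. By locality, $\delta$ extends to $\operatorname{Lip}(X)$ (truncate $f$ at height $k$ on $\{k-1\le|f|<k\}$).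 A tuple $(\delta_i)_{i=1}^m$ is *linearly independent* if $\lambda_i\in L^\infty(X;\mu)$, $\sum_i\lambda_i\delta_i=0$ imply $\lambda_1=\dots=\lambda_m=0$; $\Upsilon(X,\mu)$ *has rank $m$* if some $m$ derivations are linearly independent and no $m+1$ are; a *basis* is then a linearly independent $m$-tuple. A tuple $\mathbf g=(g_1,\dots,g_n)$ in $\operatorname{Lip}(X)$ *generates* $\operatorname{Lip}_b(X)$ if for every ball $B\subseteq X$ and every $f\in\operatorname{Lip}_b(X)$ there are polynomials $p_k$ in $n$ variables with $p_k\circ\mathbf g\stackrel{*}{\rightharpoonup}f$ in $\operatorname{Lip}_b(B)$. $\operatorname{Lip}_b(X)$ is *$N$-generated* if some $N$-tuple, but no $(N-1)$-tuple, generates it. $X$ satisfies the *Lip-derivation inequality* if there are a linearly independent tuple $\mathbf d=(\delta_i)_{i=1}^n$ of derivations and $K\ge1$ such that for every $f\in\operatorname{Lip}(X)$, $$K^{-1}|\mathbf d f(x)|\le\operatorname{Lip}[f](x)\le K|\mathbf d f(x)|\quad\text{for }\mu\text{-a.e. }x\in X .$$ For a Lipschitz map $\xi:X\to\mathbb R^n$,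 call $v\in\mathbb R^n$ a *differential* of $f$ at $x$ with respect to $\xi$ if $\operatorname{Lip}[f-v\cdot\xi](x)=0$. A $\mu$-measurable set $Y$ with $\mu(Y)>0$ is a *chart* of dimension $n$ with coordinates $\xi$ if for every $f\in\operatorname{Lip}(X)$ there is a unique $Df\in L^\infty(Y;\mathbb R^n)$ such that $Df(x)$ is a differential of $f$ at $x$ with respect to $\xi$ for $\mu$-a.e. $x\in Y$. $X$ *supports a measurable differentiable structure* if there are charts $Y_1,Y_2,\dots$ (an *atlas*) of uniformly bounded dimension covering $X$ up to a $\mu$-null set; the structure is *non-degenerate* if some chart has dimension $\ge1$. Theorem. Suppose that $\Upsilon(X,\mu)$ has rank $N>0$, that $\operatorname{Lip}_b(X)$ is $N$-generated, and that $X$ satisfies the Lip-derivation inequality. Then $X$ supports a non-degenerate measurable differentiable structure. Moreover, for every $N$-tuple $\mathbf g=(g_1,\dots,g_N)$ in $\operatorname{Lip}(X)$ that generates $\operatorname{Lip}_b(X)$: 1. There is an atlas of $X$ all of whose charts have the same coordinates $\mathbf g:X\to\mathbb R^N$. 2. For every $f\in\operatorname{Lip}(X)$ there is a $\mu$-measurable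 $Df:X\to\mathbb R^N$, unique up to null sets, such that $Df(x)$ is a differential of $f$ at $x$ with respect to $\mathbf g$ for $\mu$-a.e. $x\in X$. 3. Let $\mathbf e=(e_1,\dots,e_N)$ be any basis of $\Upsilon(X,\mu)$. Then $\mathbf{eg}(x)=[e_ig_j(x)]_{i,j=1}^N$ is invertible for $\mu$-a.e. $x$, and for every $f\in\operatorname{Lip}(X)$, $Df=(\mathbf{eg})^{-1}\,\mathbf e f$ $\mu$-a.e. Every $\mu$-measurable set $Y$ with $\mu(Y)>0$ on which the entries of $(\mathbf{eg})^{-1}$ are essentially bounded is a chart with coordinates $\mathbf g$; in particular $X$ itself is a single chart if they are essentially bounded on $X$. 4. There is a basis $\mathbf e$ of $\Upsilon(X,\mu)$ with $e_ig_j=0$ for $i\ne j$ and $e_1g_1=\dots=e_Ng_N\neq0$ $\mu$-a.e., and for such a basis $D f=(e_1g_1)^{-1}\,\mathbf e f$ $\mu$-a.e. for every $f\in\operatorname{Lip}(X)$. -/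

import Mathlib

open Set Filter Topology MeasureTheory
open scoped NNReal ENNReal Matrix

noncomputable section

namespace LipDiff

/-- `f` restricted to `s` is Lipschitz and bounded, with `max {L(f), ‖f‖_∞} ≤ K` on `s`. -/
def LipNormLE {X : Type*} [MetricSpace X] (s : Set X) (f : X → ℝ) (K : ℝ≥0) : Prop :=
  LipschitzOnWith K f s ∧ ∀ x ∈ s, |f x| ≤ K

/-- `Lip(X)`: the real-valued Lipschitz functions on `X`. -/
def LipFun (X : Type*) [MetricSpace X] : Type _ :=
  {f : X → ℝ // ∃ K : ℝ≥0, LipschitzWith K f}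

instance {X : Type*} [MetricSpace X] : CoeFun (LipFun X) (fun _ => X → ℝ) :=
  ⟨fun f => f.1⟩

theorem lipNormLE_add {X : Type*} [MetricSpace X] {f g : X → ℝ} {K L : ℝ≥0}
    (hf : LipNormLE univ f K) (hg : LipNormLE univ g L) : LipNormLE univ (f + g) (K + L) := by
  refine ⟨?_, fun x hx => ?_⟩
  · exact hf.1.add hg.1
  · have h1 := hf.2 x hx
    have h2 := hg.2 x hx
    have h3 := abs_add_le (f x) (g x)
    simp only [Pi.add_apply, NNReal.coe_add]
    linarith

theorem lipNormLE_mul {X : Type*} [MetricSpace X] {f g : X → ℝ} {K L : ℝ≥0}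
    (hf : LipNormLE univ f K) (hg : LipNormLE univ g L) :
    LipNormLE univ (f * g) (2 * K * L) := by
  refine ⟨LipschitzOnWith.of_dist_le_mul fun x hx y hy => ?_, fun x hx => ?_⟩
  · have h1 := hf.1.dist_le_mul x hx y hy
    have h2 := hg.1.dist_le_mul x hx y hy
    have h3 := hf.2 x hx
    have h4 := hg.2 y hy
    rw [Real.dist_eq] at h1 h2 ⊢
    have h5 : (f * g) x - (f * g) y = f x * (g x - g y) + g y * (f x - f y) := by
      simp only [Pi.mul_apply]; ring
    have h6 : |f x * (g x - g y)| ≤ K * (L * dist x y) := by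
      rw [abs_mul]; gcongr
    have h7 : |g y * (f x - f y)| ≤ L * (K * dist x y) := by
      rw [abs_mul]; gcongr
    rw [h5]
    push_cast
    have h8 := abs_add_le (f x * (g x - g y)) (g y * (f x - f y))
    linarith
  · have h3 := hf.2 x hx
    have h4 := hg.2 x hx
    have h5 : |(f * g) x| ≤ K * L := by
      simp only [Pi.mul_apply, abs_mul]; gcongr
    have h6 : (0 : ℝ) ≤ K * L := by positivity
    push_cast
    linarith

/-- `Lip_b(X)`: the algebra of bounded real-valued Lipschitz functions on `X`. -/
def LipB (X : Type*) [MetricSpace X] : Subalgebra ℝ (X → ℝ) where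
  carrier := {f | ∃ K : ℝ≥0, LipNormLE univ f K}
  mul_mem' := by
    rintro f g ⟨K, hf⟩ ⟨L, hg⟩
    exact ⟨_, lipNormLE_mul hf hg⟩
  add_mem' := by
    rintro f g ⟨K, hf⟩ ⟨L, hg⟩
    exact ⟨_, lipNormLE_add hf hg⟩
  algebraMap_mem' := by
    intro c
    refine ⟨‖c‖₊, LipschitzOnWith.of_dist_le_mul fun x _ y _ => ?_, fun x _ => ?_⟩
    · simp only [Pi.algebraMap_apply, dist_self]
      positivity
    · simp [Pi.algebraMap_apply]

/-- Sequential weak-star convergence in `Lip_b(s)`: pointwise convergence on `s` together with a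
uniform bound on the Lipschitz norms over `s`. -/
def LipWeakStar {X : Type*} [MetricSpace X] (s : Set X) (F : ℕ → X → ℝ) (f : X → ℝ) : Prop :=
  (∀ x ∈ s, Tendsto (fun n => F n x) atTop (𝓝 (f x))) ∧
    ∃ K : ℝ≥0, ∀ n, LipNormLE s (F n) K

/-- A metric derivation: a bounded linear operator `Lip_b(X) → L^∞(X; μ)` satisfying the Leibniz
rule and carrying weak-star convergent sequences to weak-star convergent sequences. -/
structure MetricDerivation {X : Type*} [MetricSpace X] [MeasurableSpace X] (μ : Measure X) where
  toLinearMap : LipB X →ₗ[ℝ] Lp ℝ ∞ μ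
  bounded : ∃ C : ℝ, ∀ (f : LipB X) (K : ℝ≥0), LipNormLE univ (f : X → ℝ) K →
    ‖toLinearMap f‖ ≤ C * K
  leibniz : ∀ f g : LipB X, toLinearMap (f * g) =ᵐ[μ]
    fun x => (f : X → ℝ) x * toLinearMap g x + (g : X → ℝ) x * toLinearMap f x
  weakCont : ∀ (F : ℕ → LipB X) (f : LipB X), LipWeakStar univ (fun n => (F n : X → ℝ)) f →
    ∀ φ : X → ℝ, Integrable φ μ →
      Tendsto (fun n => ∫ x, toLinearMap (F n) x * φ x ∂μ) atTop
        (𝓝 (∫ x, toLinearMap f x * φ x ∂μ))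

/-- The truncation `max (-k) (min f k)` of a Lipschitz function, as an element of `Lip_b(X)`. -/
def LipFun.trunc {X : Type*} [MetricSpace X] (f : LipFun X) (k : ℕ) : LipB X :=
  ⟨fun x => max (-(k : ℝ)) (min (f x) k), by
    obtain ⟨K, hK⟩ := f.2
    refine ⟨max K k, ?_, fun x _ => ?_⟩
    · exact (((hK.min_const (k : ℝ)).const_max (-(k : ℝ))).weaken (le_max_left _ _)).lipschitzOnWith
    · have hk : (0 : ℝ) ≤ k := Nat.cast_nonneg k
      have h1 : |max (-(k : ℝ)) (min (f x) k)| ≤ k :=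
        abs_le.2 ⟨le_max_left _ _, max_le (by linarith) (min_le_right _ _)⟩
      refine h1.trans ?_
      simp⟩

/-- The action of a derivation on an arbitrary (possibly unbounded) Lipschitz function `f`: on the
set `{k - 1 ≤ |f| < k}` it is the value of the derivation on the truncation of `f` at height `k`.
By locality this is, up to null sets, the only extension compatible with restriction to sets where
`f` agrees with a bounded Lipschitz function. -/
def MetricDerivation.onLip {X : Type*} [MetricSpace X] [MeasurableSpace X] {μ : Measure X}
    (δ : MetricDerivation μ) (f : LipFun X) : X → ℝ :=
  fun x => δ.toLinearMap (f.trunc (⌊|f x|⌋₊ + 1)) x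

/-- Linear independence of derivations over the ring `L^∞(X; μ)`. -/
def LinIndep {X : Type*} [MetricSpace X] [MeasurableSpace X] {μ : Measure X} {m : ℕ}
    (d : Fin m → MetricDerivation μ) : Prop :=
  ∀ c : Fin m → Lp ℝ ∞ μ,
    (∀ f : LipB X, (fun x => ∑ i, c i x * (d i).toLinearMap f x) =ᵐ[μ] 0) → ∀ i, c i = 0

/-- The module of derivations has rank `m`. -/
def HasRank {X : Type*} [MetricSpace X] [MeasurableSpace X] (μ : Measure X) (m : ℕ) : Prop :=
  (∃ d : Fin m → MetricDerivation μ, LinIndep d) ∧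
    ∀ d : Fin (m + 1) → MetricDerivation μ, ¬ LinIndep d

/-- The tuple `g` generates `Lip_b(X)`: on every ball, every bounded Lipschitz function is the
weak-star limit of a sequence of polynomials in `g`. (A polynomial is automatically bounded and
Lipschitz on the bounded set `g(B)`.) -/
def Generates {X : Type*} [MetricSpace X] {n : ℕ} (g : Fin n → LipFun X) : Prop :=
  ∀ (a : X) (r : ℝ) (f : LipB X), ∃ p : ℕ → MvPolynomial (Fin n) ℝ,
    LipWeakStar (Metric.ball a r) (fun k x => MvPolynomial.eval (fun i => g i x) (p k)) f

/-- `Lip_b(X)` is `N`-generated. -/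
def IsNGenerated (X : Type*) [MetricSpace X] (N : ℕ) : Prop :=
  (∃ g : Fin N → LipFun X, Generates g) ∧
    ∀ M : ℕ, M + 1 = N → ∀ h : Fin M → LipFun X, ¬ Generates h

/-- The pointwise Lipschitz constant
`Lip[f](x) = limsup_{r → 0} sup_{y ∈ closedBall x r} |f(y) - f(x)| / r`. -/
def ptLip {X : Type*} [MetricSpace X] (f : X → ℝ) (x : X) : ℝ≥0∞ :=
  limsup (fun r : ℝ => ⨆ y ∈ Metric.closedBall x r, ENNReal.ofReal (|f y - f x| / r)) (𝓝[>] 0)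

/-- The Lip-derivation inequality on `X`, for some linearly independent tuple of derivations. -/
def LipDerivationInequality {X : Type*} [MetricSpace X] [MeasurableSpace X]
    (μ : Measure X) : Prop :=
  ∃ (n : ℕ) (d : Fin n → MetricDerivation μ), LinIndep d ∧
    ∃ K : ℝ, 1 ≤ K ∧ ∀ f : LipFun X, ∀ᵐ x ∂μ,
      ENNReal.ofReal (K⁻¹ * ‖WithLp.toLp 2 (fun i => (d i).onLip f x)‖) ≤ ptLip f x ∧
        ptLip f x ≤ ENNReal.ofReal (K * ‖WithLp.toLp 2 (fun i => (d i).onLip f x)‖)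

/-- `v` is a differential of `f` at `x` with respect to `ξ`, i.e. `Lip[f - v · ξ](x) = 0`. -/
def IsDifferentialAt {X : Type*} [MetricSpace X] {n : ℕ} (ξ : X → EuclideanSpace ℝ (Fin n))
    (f : LipFun X) (x : X) (v : EuclideanSpace ℝ (Fin n)) : Prop :=
  ptLip (fun y => f y - inner ℝ v (ξ y)) x = 0

/-- `Y` is a chart of differentiability on `X` with coordinates `ξ` and chart dimension `n`. -/
def IsChart {X : Type*} [MetricSpace X] [MeasurableSpace X] (μ : Measure X) (Y : Set X) {n : ℕ}
    (ξ : X → EuclideanSpace ℝ (Fin n)) : Prop :=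
  NullMeasurableSet Y μ ∧ 0 < μ Y ∧ (∃ K : ℝ≥0, LipschitzWith K ξ) ∧
    ∀ f : LipFun X, ∃! D : Lp (EuclideanSpace ℝ (Fin n)) ∞ (μ.restrict Y),
      ∀ᵐ x ∂(μ.restrict Y), IsDifferentialAt ξ f x (D x)

/-- The sets `Y m` with coordinates `ξ m` form an atlas of a measurable differentiable structure. -/
def IsAtlas {X : Type*} [MetricSpace X] [MeasurableSpace X] (μ : Measure X) (Y : ℕ → Set X)
    (n : ℕ → ℕ) (ξ : ∀ m, X → EuclideanSpace ℝ (Fin (n m))) : Prop :=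
  μ (⋃ m, Y m)ᶜ = 0 ∧ (∀ m, IsChart μ (Y m) (ξ m)) ∧ ∃ N, ∀ m, n m ≤ N

/-- `(X, d, μ)` supports a non-degenerate measurable differentiable structure. -/
def SupportsNondegenerateMDS {X : Type*} [MetricSpace X] [MeasurableSpace X]
    (μ : Measure X) : Prop :=
  ∃ (Y : ℕ → Set X) (n : ℕ → ℕ) (ξ : ∀ m, X → EuclideanSpace ℝ (Fin (n m))),
    IsAtlas μ Y n ξ ∧ ∃ m, 1 ≤ n m

/-- The map `x ↦ (g_1(x), …, g_n(x))` into Euclidean space. -/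
def coords {X : Type*} [MetricSpace X] {n : ℕ} (g : Fin n → LipFun X) :
    X → EuclideanSpace ℝ (Fin n) :=
  fun x => WithLp.toLp 2 (fun i => g i x)

/-- The Jacobi matrix with entry `δ_i g_j (x)` in place `(i, j)`. -/
def jacobi {X : Type*} [MetricSpace X] [MeasurableSpace X] {μ : Measure X} {n : ℕ}
    (d : Fin n → MetricDerivation μ) (g : Fin n → LipFun X) (x : X) : Matrix (Fin n) (Fin n) ℝ :=
  Matrix.of fun i j => (d i).onLip (g j) x

end LipDiff

end

open LipDiff

noncomputable section

namespace LipDiff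

/-! A derivation is determined by its values on a generating tuple `g`. If it kills every g_j, then
by Leibniz it kills every polynomial in them, and weak-star continuity, applied after multiplication
by a cutoff, carries this to all of Lip_b (`MetricDerivation.eq_zero_of_generates`).

This has two consequences for independent derivations e = (e_1, ..., e_N). A nontrivial measurable
relation among the rows of the Jacobi matrix eg, scaled pointwise into L^∞, would give a vanishing
combination of the e_i; hence eg is invertible a.e. (`LinIndep.ae_isUnit_det_jacobi`). For any
derivation δ, the combination δ - Σ a_i e_i with a = (δg)(eg)⁻¹, again after scaling, kills g and so
everything. This is the chain rule δf = Σ_j v_j δg_j with v = (eg)⁻¹ ef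
(`MetricDerivation.onLip_eq_sum_diff`).

Existence (`ae_isDifferentialAt_diff`): by the chain rule and the Lip-derivation inequality, Lip[f -
w·g](x) is at most K times the norm of Σ_j (v_j - w_j) dg_j(x), and w may tend to v(x). Uniqueness
(`ae_eq_diff_of_isDifferentialAt`): boundedness and locality give |δf| ≤ C Lip[f] a.e. for every
derivation, so a differential must solve (eg)v = ef. Where (eg)⁻¹ is bounded, v is in L^∞ and the
set is a chart; such sets exhaust X. The scalar basis is e multiplied by the adjugate of eg, scaled
to be bounded. -/

theorem ae_abs_le_norm_top {Y : Type*} [MeasurableSpace Y] {ν : Measure Y} (u : Lp ℝ ∞ ν) :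
    ∀ᵐ x ∂ν, |u x| ≤ ‖u‖ := by
  filter_upwards [ae_le_eLpNormEssSup (f := u) (μ := ν)] with x hx
  rw [Lp.norm_def, eLpNorm_exponent_top, ← Real.norm_eq_abs, ← toReal_enorm]
  refine ENNReal.toReal_mono ?_ hx
  rw [← eLpNorm_exponent_top]
  exact Lp.eLpNorm_ne_top _

/-! ### Elementary Lipschitz functions and the pointwise Lipschitz constant. -/

section Basic

variable {X : Type*} [MetricSpace X]

theorem LipFun.continuous (f : LipFun X) : Continuous f.1 := f.2.choose_spec.continuous

theorem LipB.exists_lipschitzWith (f : LipB X) : ∃ K : ℝ≥0, LipschitzWith K (f : X → ℝ) := by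
  obtain ⟨K, hK⟩ := f.2
  exact ⟨K, lipschitzOnWith_univ.1 hK.1⟩

theorem LipB.continuous (f : LipB X) : Continuous (f : X → ℝ) :=
  (LipB.exists_lipschitzWith f).choose_spec.continuous

/-- A bounded Lipschitz function as an element of `Lip_b(X)`. -/
def LipB.mk (f : X → ℝ) (L M : ℝ≥0) (hf : LipschitzWith L f) (hM : ∀ x, |f x| ≤ M) : LipB X :=
  ⟨f, max L M, (hf.weaken (le_max_left _ _)).lipschitzOnWith, fun x _ => (hM x).trans (by simp)⟩

@[simp] theorem LipFun.coe_trunc (f : LipFun X) (k : ℕ) :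
    (f.trunc k : X → ℝ) = fun x => max (-(k : ℝ)) (min (f x) k) := rfl

theorem LipFun.trunc_eq {f : LipFun X} {k : ℕ} {x : X} (h : |f x| ≤ k) :
    (f.trunc k : X → ℝ) x = f x := by
  have := abs_le.1 h
  simp [this.1, this.2]

theorem LipFun.trunc_floor (f : LipFun X) (x : X) :
    (f.trunc (⌊|f x|⌋₊ + 1) : X → ℝ) x = f x :=
  LipFun.trunc_eq (by push_cast; exact (Nat.lt_floor_add_one _).le)

theorem abs_clamp_le {ε : ℝ} (hε : 0 ≤ ε) (t : ℝ) : |max (-ε) (min t ε)| ≤ ε :=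
  abs_le.2 ⟨le_max_left _ _, max_le (by linarith) (min_le_right _ _)⟩

theorem clamp_eq {ε t : ℝ} (h : |t| ≤ ε) : max (-ε) (min t ε) = t := by
  have := abs_le.1 h
  rw [min_eq_left this.2, max_eq_right this.1]

theorem exists_lipschitzWith_coords {n : ℕ} (g : Fin n → LipFun X) :
    ∃ K : ℝ≥0, LipschitzWith K (coords g) := by
  choose K hK using fun j => (g j).2
  have h1 : LipschitzWith (∑ j, K j) (fun x => fun j => g j x) :=
    LipschitzWith.of_dist_le_mul fun x y => by
      refine (dist_pi_le_iff (by positivity)).2 fun j => ((hK j).dist_le_mul x y).trans ?_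
      gcongr
      exact_mod_cast Finset.single_le_sum (f := K) (fun _ _ => zero_le) (Finset.mem_univ j)
  exact ⟨_, (PiLp.lipschitzWith_toLp 2 (fun _ : Fin n => ℝ)).comp h1⟩

theorem inner_coords {n : ℕ} (g : Fin n → LipFun X) (v : EuclideanSpace ℝ (Fin n)) (x : X) :
    inner ℝ v (coords g x) = ∑ j, v j * g j x := by
  simp [coords, PiLp.inner_apply, mul_comm]

theorem lipschitzWith_inner_coords {n : ℕ} {g : Fin n → LipFun X} {K : ℝ≥0}
    (hK : LipschitzWith K (coords g)) (v : EuclideanSpace ℝ (Fin n)) :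
    LipschitzWith (‖v‖₊ * K) (fun x => inner ℝ v (coords g x)) :=
  LipschitzWith.of_dist_le_mul fun x y => by
    rw [Real.dist_eq, ← inner_sub_right]
    refine (abs_real_inner_le_norm _ _).trans ?_
    rw [← dist_eq_norm]
    push_cast
    rw [mul_assoc]
    exact mul_le_mul_of_nonneg_left (hK.dist_le_mul x y) (norm_nonneg _)

/-- The Lipschitz function `f - v · g`. -/
def LipFun.subInner (f : LipFun X) {n : ℕ} (g : Fin n → LipFun X)
    (v : EuclideanSpace ℝ (Fin n)) : LipFun X :=
  ⟨fun x => f x - inner ℝ v (coords g x), by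
    obtain ⟨K, hK⟩ := exists_lipschitzWith_coords g
    obtain ⟨L, hL⟩ := f.2
    exact ⟨_, hL.sub (lipschitzWith_inner_coords hK v)⟩⟩

/-- `f` varies near `x` at most at the linear rate `q`. -/
def LipAt (f : X → ℝ) (x : X) (q : ℝ) : Prop :=
  ∃ r : ℝ, 0 < r ∧ ∀ y, dist y x < r → |f y - f x| ≤ q * dist y x

theorem LipAt.mono {f : X → ℝ} {x : X} {p q : ℝ} (h : LipAt f x p) (hpq : p ≤ q) :
    LipAt f x q := by
  obtain ⟨r, hr, h⟩ := h
  exact ⟨r, hr, fun y hy => (h y hy).trans (by gcongr)⟩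

theorem LipAt.add {f h : X → ℝ} {x : X} {p q : ℝ} (hf : LipAt f x p) (hh : LipAt h x q) :
    LipAt (fun y => f y + h y) x (p + q) := by
  obtain ⟨r, hr, hf⟩ := hf
  obtain ⟨s, hs, hh⟩ := hh
  refine ⟨min r s, lt_min hr hs, fun y hy => ?_⟩
  have h1 := hf y (hy.trans_le (min_le_left _ _))
  have h2 := hh y (hy.trans_le (min_le_right _ _))
  have h3 := abs_add_le (f y - f x) (h y - h x)
  rw [show f y + h y - (f x + h x) = (f y - f x) + (h y - h x) by ring, add_mul]
  linarith

theorem lipAt_of_lipschitzWith {f : X → ℝ} {K : ℝ≥0} (hf : LipschitzWith K f) (x : X) :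
    LipAt f x K :=
  ⟨1, one_pos, fun y _ => hf.dist_le_mul y x⟩

theorem LipAt.ptLip_le {f : X → ℝ} {x : X} {q : ℝ} (hq : 0 ≤ q) (h : LipAt f x q) :
    ptLip f x ≤ ENNReal.ofReal q := by
  obtain ⟨r, hr, h⟩ := h
  refine limsup_le_of_le (h := ?_)
  filter_upwards [Ioo_mem_nhdsGT hr] with s hs
  refine iSup₂_le fun y hy => ENNReal.ofReal_le_ofReal ?_
  rw [div_le_iff₀ hs.1]
  exact (h y ((Metric.mem_closedBall.1 hy).trans_lt hs.2)).trans
    (mul_le_mul_of_nonneg_left hy hq)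

/-- Strictness makes the limsup bound hold for all small radii; for a point `y` the radius to use is
`dist y x` itself. -/
theorem lipAt_of_ptLip_lt {f : X → ℝ} {x : X} {q : ℝ} (h : ptLip f x < ENNReal.ofReal q) :
    LipAt f x q := by
  have h1 := eventually_lt_of_limsup_lt h
  obtain ⟨r, hr, h1⟩ := mem_nhdsGT_iff_exists_Ioo_subset.1 h1
  refine ⟨r, hr, fun y hy => ?_⟩
  rcases eq_or_ne y x with rfl | hne
  · simp
  · have hpos : 0 < dist y x := dist_pos.2 hne
    have h2 : (⨆ z ∈ Metric.closedBall x (dist y x),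
        ENNReal.ofReal (|f z - f x| / dist y x)) < ENNReal.ofReal q := h1 ⟨hpos, hy⟩
    have h3 : ENNReal.ofReal (|f y - f x| / dist y x) < ENNReal.ofReal q :=
      (le_iSup₂ (f := fun z (_ : z ∈ Metric.closedBall x (dist y x)) =>
        ENNReal.ofReal (|f z - f x| / dist y x)) y (Metric.mem_closedBall.2 le_rfl)).trans_lt h2
    have h4 := (ENNReal.ofReal_lt_ofReal_iff_of_nonneg (by positivity)).1 h3
    exact ((div_lt_iff₀ hpos).1 h4).le

theorem ptLip_le_add {f h : X → ℝ} {x : X} {p q : ℝ} (hp : 0 ≤ p) (hq : 0 ≤ q)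
    (hf : ptLip f x ≤ ENNReal.ofReal p) (hh : LipAt h x q) :
    ptLip (fun y => f y + h y) x ≤ ENNReal.ofReal (p + q) := by
  refine ENNReal.le_of_forall_pos_le_add fun ε hε _ => ?_
  have h1 : LipAt f x (p + ε) := lipAt_of_ptLip_lt (hf.trans_lt
    ((ENNReal.ofReal_lt_ofReal_iff (by positivity)).2 (by simpa using hε)))
  refine ((h1.add hh).ptLip_le (by positivity)).trans ?_
  rw [← ENNReal.ofReal_coe_nnreal, ← ENNReal.ofReal_add (by positivity) (by positivity)]
  exact ENNReal.ofReal_le_ofReal (by linarith)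

end Basic

/-! ### Locality of derivations and pointwise bounds for their extension to Lip(X). -/

section Derivation

variable {X : Type*} [MetricSpace X] [MeasurableSpace X] {μ : Measure X}

theorem MetricDerivation.map_one (δ : MetricDerivation μ) : ∀ᵐ x ∂μ, δ.toLinearMap 1 x = 0 := by
  have := δ.leibniz 1 1
  rw [mul_one] at this
  filter_upwards [this] with x hx
  simp at hx
  linarith

/-- Vanishing on a measurable set is preserved under weak-star limits. -/
theorem MetricDerivation.eq_zero_of_lipWeakStar [SigmaFinite μ] (δ : MetricDerivation μ)
    {F : ℕ → LipB X} {f : LipB X}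
    (hF : LipWeakStar univ (fun n => (F n : X → ℝ)) f) {s : Set X} (hs : MeasurableSet s)
    (h0 : ∀ n, ∀ᵐ x ∂μ, x ∈ s → δ.toLinearMap (F n) x = 0) :
    ∀ᵐ x ∂μ, x ∈ s → δ.toLinearMap f x = 0 := by
  have key : s.indicator (δ.toLinearMap f) =ᵐ[μ] 0 := by
    refine ae_eq_zero_of_forall_setIntegral_eq_of_sigmaFinite (fun t ht hμt => ?_)
      fun t ht hμt => ?_
    · have : MemLp (δ.toLinearMap f) ∞ (μ.restrict t) := (Lp.memLp _).restrict t
      have hfin : IsFiniteMeasure (μ.restrict t) := ⟨by simpa using hμt⟩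
      exact (this.integrable le_top).indicator hs
    · have hφ : Integrable ((s ∩ t).indicator (fun _ => (1 : ℝ))) μ :=
        (integrable_indicator_iff (hs.inter ht)).2
          (integrableOn_const ((measure_mono inter_subset_right).trans_lt hμt).ne)
      have hlim := δ.weakCont F f hF _ hφ
      have hz : ∀ n, ∫ x, δ.toLinearMap (F n) x * (s ∩ t).indicator (fun _ => (1 : ℝ)) x ∂μ = 0 := by
        intro n
        refine integral_eq_zero_of_ae ?_
        filter_upwards [h0 n] with x hx
        by_cases hxs : x ∈ s
        · simp [hx hxs]
        · simp [hxs]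
      simp only [hz] at hlim
      have h2 := tendsto_nhds_unique hlim tendsto_const_nhds
      rw [← integral_indicator ht, ← h2]
      refine integral_congr_ae (.of_forall fun x => ?_)
      by_cases hxs : x ∈ s <;> by_cases hxt : x ∈ t <;> simp [hxs, hxt]
  filter_upwards [key] with x hx hxs
  simpa [hxs] using hx

/-- Locality: a derivation of `f` vanishes almost everywhere on the zero set of `f`. -/
theorem MetricDerivation.locality_zero [BorelSpace X] [SigmaFinite μ] (δ : MetricDerivation μ)
    (f : LipB X) : ∀ᵐ x ∂μ, (f : X → ℝ) x = 0 → δ.toLinearMap f x = 0 := by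
  obtain ⟨K, hK, hKb⟩ := f.2
  have hK' := lipschitzOnWith_univ.1 hK
  set ε : ℕ → ℝ≥0 := fun n => 1 / ((n : ℝ≥0) + 1) with hε
  have hεpos : ∀ n, 0 < (ε n : ℝ) := fun n => by simp only [hε]; positivity
  have hεle : ∀ n, (ε n : ℝ) ≤ 1 := fun n => by
    simp only [hε]; push_cast
    rw [div_le_one (by positivity)]
    linarith [(Nat.cast_nonneg n : (0 : ℝ) ≤ n)]
  -- Clamping at height ε_n → 0 makes `f - T n` converge weak-star to `f` while vanishing where |f|
  -- ≤ ε_n. The function `χ n` is 1 off that set and 0 on {f = 0}, so `f - T n = (f - T n) * χ n` is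
  -- a product of two functions vanishing on {f = 0}, and Leibniz kills it there.
  set T : ℕ → LipB X := fun n =>
    LipB.mk (fun x => max (-(ε n : ℝ)) (min ((f : X → ℝ) x) (ε n))) K (ε n)
      ((hK'.min_const _).const_max _) (fun x => abs_clamp_le (hεpos n).le _) with hT
  set χ : ℕ → LipB X := fun n =>
    LipB.mk (fun x => min 1 ((ε n : ℝ)⁻¹ * |(f : X → ℝ) x|)) ((ε n)⁻¹ * K) 1
      (by
        refine LipschitzWith.const_min ?_ _
        refine LipschitzWith.of_dist_le_mul fun x y => ?_
        have h1 := hK'.dist_le_mul x y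
        rw [Real.dist_eq] at h1 ⊢
        rw [← mul_sub, abs_mul, abs_of_pos (inv_pos.2 (hεpos n))]
        push_cast
        rw [mul_assoc]
        exact mul_le_mul_of_nonneg_left ((abs_abs_sub_abs_le_abs_sub _ _).trans h1)
          (inv_pos.2 (hεpos n)).le)
      (fun x => by
        have : 0 ≤ (ε n : ℝ)⁻¹ * |(f : X → ℝ) x| := by positivity
        rw [abs_of_nonneg (le_min zero_le_one this)]
        simp) with hχ
  have hprod : ∀ n, (f - T n) * χ n = f - T n := by
    intro n
    ext x
    change ((f : X → ℝ) x - max (-(ε n : ℝ)) (min ((f : X → ℝ) x) (ε n))) *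
      min 1 ((ε n : ℝ)⁻¹ * |(f : X → ℝ) x|) = (f : X → ℝ) x - max (-(ε n : ℝ)) (min ((f : X → ℝ) x) (ε n))
    rcases le_total |(f : X → ℝ) x| (ε n) with h | h
    · rw [clamp_eq h]; simp
    · have h1 : (1 : ℝ) ≤ (ε n : ℝ)⁻¹ * |(f : X → ℝ) x| := by
        rw [inv_mul_eq_div, le_div_iff₀ (hεpos n)]
        linarith
      rw [min_eq_left h1, mul_one]
  refine δ.eq_zero_of_lipWeakStar (F := fun n => f - T n)
    (s := (f : X → ℝ) ⁻¹' {0}) ⟨fun x _ => ?_, K + (K + 1), fun n => ?_⟩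
    ((LipB.continuous f).measurable (measurableSet_singleton _)) fun n => ?_
  · have h1 : Tendsto (fun n => (ε n : ℝ)) atTop (𝓝 0) := by
      have := tendsto_one_div_add_atTop_nhds_zero_nat (𝕜 := ℝ)
      refine this.congr fun n => ?_
      simp [hε]
    have h2 : Tendsto (fun n => max (-(ε n : ℝ)) (min ((f : X → ℝ) x) (ε n))) atTop (𝓝 0) :=
      squeeze_zero_norm (fun n => abs_clamp_le (hεpos n).le _) h1
    have h3 := (tendsto_const_nhds (x := (f : X → ℝ) x)).sub h2
    rw [sub_zero] at h3
    exact h3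
  · refine ⟨?_, fun x _ => ?_⟩
    · refine (hK.sub ((hK'.min_const _).const_max _).lipschitzOnWith).weaken ?_
      gcongr; simp
    · have h1 := hKb x (mem_univ x)
      have h2 := abs_clamp_le (hεpos n).le ((f : X → ℝ) x)
      have h3 := abs_sub ((f : X → ℝ) x) (max (-(ε n : ℝ)) (min ((f : X → ℝ) x) (ε n)))
      change |(f : X → ℝ) x - max (-(ε n : ℝ)) (min ((f : X → ℝ) x) (ε n))| ≤ _
      push_cast
      have := hεle n
      have := K.2
      linarith [(K.2 : (0:ℝ) ≤ K)]
  · have hl := δ.leibniz (f - T n) (χ n)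
    rw [hprod n] at hl
    filter_upwards [hl] with x hx hx0
    rw [hx]
    have hx0 : (f : X → ℝ) x = 0 := hx0
    have e1 : ((f - T n : LipB X) : X → ℝ) x = 0 := by
      change (f : X → ℝ) x - max (-(ε n : ℝ)) (min ((f : X → ℝ) x) (ε n)) = 0
      rw [hx0, clamp_eq (by simp)]; simp
    have e2 : (χ n : X → ℝ) x = 0 := by
      change min 1 ((ε n : ℝ)⁻¹ * |(f : X → ℝ) x|) = 0
      rw [hx0]; simp
    rw [e1, e2]; simp

/-- The additive constant is free because derivations kill constants; it is needed for functions
recentred at a point and for cutoffs equal to 1. -/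
theorem MetricDerivation.locality [BorelSpace X] [SigmaFinite μ] (δ : MetricDerivation μ)
    (f h : LipB X) (c : ℝ) :
    ∀ᵐ x ∂μ, (f : X → ℝ) x = (h : X → ℝ) x + c → δ.toLinearMap f x = δ.toLinearMap h x := by
  have h0 := δ.locality_zero (f - h - c • 1)
  rw [map_sub, map_sub, map_smul] at h0
  filter_upwards [h0, δ.map_one, Lp.coeFn_sub (δ.toLinearMap f - δ.toLinearMap h) (c • δ.toLinearMap 1),
    Lp.coeFn_sub (δ.toLinearMap f) (δ.toLinearMap h), Lp.coeFn_smul c (δ.toLinearMap 1)]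
    with x hx h1 h2 h3 h4 hfx
  rw [h2, Pi.sub_apply, h3, h4, Pi.sub_apply, Pi.smul_apply, h1, smul_zero, sub_zero] at hx
  refine sub_eq_zero.1 (hx ?_)
  change (f : X → ℝ) x - (h : X → ℝ) x - c * 1 = 0
  rw [hfx]; ring

/-- The truncation height in `onLip` varies with `x`, but only countably many heights occur, so
locality holds for all of them off one null set. -/
theorem MetricDerivation.onLip_eq [BorelSpace X] [SigmaFinite μ] (δ : MetricDerivation μ)
    (f : LipFun X) (h : LipB X) (c : ℝ) :
    ∀ᵐ x ∂μ, f x = (h : X → ℝ) x + c → δ.onLip f x = δ.toLinearMap h x := by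
  filter_upwards [ae_all_iff.2 fun k => δ.locality (f.trunc k) h c] with x hx hfx
  exact hx _ (by rw [f.trunc_floor]; exact hfx)

theorem measurable_eval_nat {Y : Type*} [MeasurableSpace Y] {F : ℕ → Y → ℝ}
    (hF : ∀ k, Measurable (F k)) {n : Y → ℕ} (hn : Measurable n) :
    Measurable (fun x => F (n x) x) :=
  (measurable_from_prod_countable_right (f := fun p : ℕ × Y => F p.1 p.2) hF).comp
    (hn.prodMk measurable_id)

theorem MetricDerivation.measurable_onLip [BorelSpace X] (δ : MetricDerivation μ)
    (f : LipFun X) : Measurable (δ.onLip f) := by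
  refine measurable_eval_nat (fun k => (Lp.stronglyMeasurable (δ.toLinearMap (f.trunc k))).measurable)
    (n := fun x => ⌊|f x|⌋₊ + 1) ?_
  exact (Nat.measurable_floor.comp f.continuous.measurable.abs).add_const 1

/-- Linearity of the extension is not immediate, since each function is truncated at its own height.
Near a given value all of them may be compared at one common height `k`. -/
theorem MetricDerivation.onLip_subInner [BorelSpace X] [SigmaFinite μ] (δ : MetricDerivation μ)
    (f : LipFun X) {n : ℕ} (g : Fin n → LipFun X) (v : EuclideanSpace ℝ (Fin n)) :
    ∀ᵐ x ∂μ, δ.onLip (f.subInner g v) x = δ.onLip f x - ∑ j, v j * δ.onLip (g j) x := by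
  set h : ℕ → LipB X := fun k => f.trunc k - ∑ j, v j • (g j).trunc k with hh
  have hval : ∀ k x, (h k : X → ℝ) x =
      (f.trunc k : X → ℝ) x - ∑ j, v j * ((g j).trunc k : X → ℝ) x := by
    intro k x
    simp only [hh, AddSubgroupClass.coe_sub, AddSubmonoidClass.coe_finsetSum,
      Pi.sub_apply, Finset.sum_apply, Subalgebra.coe_smul, Pi.smul_apply, smul_eq_mul]
  have hmap : ∀ k, ∀ᵐ x ∂μ, δ.toLinearMap (h k) x =
      δ.toLinearMap (f.trunc k) x - ∑ j, v j * δ.toLinearMap ((g j).trunc k) x := by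
    intro k
    simp only [hh, map_sub, map_sum, map_smul]
    filter_upwards [Lp.coeFn_sub (δ.toLinearMap (f.trunc k))
      (∑ j, v j • δ.toLinearMap ((g j).trunc k)),
      Lp.coeFn_finsetSum Finset.univ (fun j => v j • δ.toLinearMap ((g j).trunc k)),
      ae_all_iff.2 fun j => Lp.coeFn_smul (v j) (δ.toLinearMap ((g j).trunc k))] with x h1 h2 h3
    rw [h1, Pi.sub_apply, h2]
    simp [h3]
  filter_upwards [ae_all_iff.2 fun k => δ.onLip_eq (f.subInner g v) (h k) 0,
    ae_all_iff.2 hmap, ae_all_iff.2 fun k => δ.onLip_eq f (f.trunc k) 0,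
    ae_all_iff.2 fun k => ae_all_iff.2 fun j => δ.onLip_eq (g j) ((g j).trunc k) 0]
    with x h1 h2 h3 h4
  obtain ⟨k, hk⟩ := exists_nat_ge (|f x| + ∑ j, |g j x|)
  have hkf : |f x| ≤ k := le_trans (le_add_of_nonneg_right (by positivity)) hk
  have hkg : ∀ j, |g j x| ≤ k := fun j =>
    le_trans (le_trans (Finset.single_le_sum (f := fun j => |g j x|) (fun _ _ => abs_nonneg _)
      (Finset.mem_univ j)) (le_add_of_nonneg_left (abs_nonneg _))) hk
  rw [h1 k, h2 k, h3 k (by rw [LipFun.trunc_eq hkf, add_zero])]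
  · congr 1
    refine Finset.sum_congr rfl fun j _ => ?_
    rw [h4 k j (by rw [LipFun.trunc_eq (hkg j), add_zero])]
  · rw [add_zero, hval, LipFun.trunc_eq hkf]
    change f x - inner ℝ v (coords g x) = _
    rw [inner_coords]
    congr 1
    refine Finset.sum_congr rfl fun j _ => ?_
    rw [LipFun.trunc_eq (hkg j)]

/-- Fix a rate and a scale. The points where `f` has that rate at that scale, taken in a small ball
about a point of a dense sequence, form a set on which `f` is `q`-Lipschitz. A Lipschitz extension
and locality then reduce the bound to the operator bound. Separability leaves countably many such
pieces, and no measurability of the pieces is used. -/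
theorem MetricDerivation.exists_bound_lipAt [TopologicalSpace.SeparableSpace X] [BorelSpace X]
    [SigmaFinite μ] (δ : MetricDerivation μ) :
    ∃ C : ℝ≥0, ∀ f : LipFun X, ∀ᵐ x ∂μ, ∀ q : ℝ, 0 ≤ q → LipAt f.1 x q →
      |δ.onLip f x| ≤ C * q := by
  obtain ⟨C, hC⟩ := δ.bounded
  refine ⟨C.toNNReal, fun f => ?_⟩
  rcases isEmpty_or_nonempty X with hX | hX
  · exact .of_forall fun x => isEmptyElim x
  have key : ∀ (q : ℝ≥0) (m i : ℕ), ∀ᵐ x ∂μ,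
      (∀ y, dist y x < 1 / ((m : ℝ) + 1) → |f y - f x| ≤ q * dist y x) →
      dist x (TopologicalSpace.denseSeq X i) < 1 / ((m : ℝ) + 1) / 2 →
      |δ.onLip f x| ≤ C.toNNReal * q := by
    intro q m i
    set S : Set X := {x | (∀ y, dist y x < 1 / ((m : ℝ) + 1) → |f y - f x| ≤ q * dist y x) ∧
      dist x (TopologicalSpace.denseSeq X i) < 1 / ((m : ℝ) + 1) / 2} with hS
    have hdist : ∀ x ∈ S, ∀ y ∈ S, dist y x < 1 / ((m : ℝ) + 1) := fun x hx y hy => by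
      have := dist_triangle_right y x (TopologicalSpace.denseSeq X i)
      linarith [hx.2, hy.2]
    rcases S.eq_empty_or_nonempty with hemp | ⟨x₀, hx₀⟩
    · exact .of_forall fun x h1 h2 => ((hemp ▸ (⟨h1, h2⟩ : x ∈ S) : x ∈ (∅ : Set X))).elim
    have hlip : LipschitzOnWith q f.1 S := LipschitzOnWith.of_dist_le_mul fun x hx y hy => by
      rw [Real.dist_eq]
      exact hy.1 x (hdist y hy x hx)
    obtain ⟨F, hF, hFS⟩ := hlip.extend_real
    have hF' : LipschitzWith q (fun x => F x - f x₀) := by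
      simpa using hF.sub (LipschitzWith.const (f x₀))
    -- Recentring at `x₀` and clamping at `q` makes the sup norm at most `q` as well. On `S` the
    -- clamp is inactive, since points of `S` are less than 1 apart.
    set h : LipB X := LipB.mk (fun x => max (-(q : ℝ)) (min (F x - f x₀) q)) q q
      ((hF'.min_const _).const_max _) (fun x => abs_clamp_le q.2 _) with hh
    have hnorm : ‖δ.toLinearMap h‖ ≤ C * q :=
      hC h q ⟨((hF'.min_const _).const_max _).lipschitzOnWith, fun x _ => abs_clamp_le q.2 _⟩
    filter_upwards [δ.onLip_eq f h (f x₀),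
      ae_abs_le_norm_top (δ.toLinearMap h)] with x h1 h2 h3 h4
    have hx : x ∈ S := ⟨h3, h4⟩
    have h5 : |F x - f x₀| ≤ q := by
      rw [← hFS hx]
      refine (hx₀.1 x (hdist x₀ hx₀ x hx)).trans (mul_le_of_le_one_right q.2 ?_)
      refine (hdist x₀ hx₀ x hx).le.trans ?_
      rw [div_le_one (by positivity)]
      linarith [(Nat.cast_nonneg m : (0 : ℝ) ≤ m)]
    rw [h1 (by
      change f x = max (-(q : ℝ)) (min (F x - f x₀) q) + f x₀
      rw [clamp_eq h5, hFS hx]; ring)]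
    refine h2.trans (hnorm.trans ?_)
    gcongr
    exact Real.le_coe_toNNReal C
  -- One null set must serve every real rate, so only rational rates are used; a real `q` is
  -- approached by rationals from above.
  have key' := ae_all_iff.2 fun q : ℚ => ae_all_iff.2 fun m =>
    ae_all_iff.2 fun i => key (q : ℝ).toNNReal m i
  filter_upwards [key'] with x hx q hq hlip
  refine le_of_forall_gt_imp_ge_of_dense fun b hb => ?_
  obtain ⟨q', hq', hb'⟩ : ∃ q' : ℚ, q < q' ∧ C.toNNReal * (q' : ℝ) ≤ b := by
    have hb0 : 0 < b - C.toNNReal * q := by linarith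
    have hc : (0 : ℝ) < C.toNNReal + 1 := by positivity
    obtain ⟨q', h1, h2⟩ := exists_rat_btwn
      (show q < q + (b - C.toNNReal * q) / (C.toNNReal + 1) by
        have := div_pos hb0 hc; linarith)
    refine ⟨q', h1, ?_⟩
    have h3 : (q' - q) * ((C.toNNReal : ℝ) + 1) < b - C.toNNReal * q := by
      rw [← lt_div_iff₀ hc]; linarith
    nlinarith
  have hq'0 : (0 : ℝ) ≤ q' := hq.trans hq'.le
  obtain ⟨r, hr, h1⟩ := hlip.mono hq'.le
  obtain ⟨m, hm⟩ := exists_nat_one_div_lt hr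
  obtain ⟨i, hi⟩ := (TopologicalSpace.denseRange_denseSeq X).exists_dist_lt x
    (show (0 : ℝ) < 1 / ((m : ℝ) + 1) / 2 by positivity)
  refine le_trans (hx q' m i (fun y hy => ?_) hi) ?_
  · rw [Real.coe_toNNReal _ hq'0]
    exact h1 y (hy.trans hm)
  · rwa [Real.coe_toNNReal _ hq'0]

theorem MetricDerivation.exists_bound_ptLip [TopologicalSpace.SeparableSpace X] [BorelSpace X]
    [SigmaFinite μ] (δ : MetricDerivation μ) :
    ∃ C : ℝ≥0, ∀ f : LipFun X, ∀ᵐ x ∂μ, ∀ q : ℝ, 0 ≤ q → ptLip f.1 x ≤ ENNReal.ofReal q →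
      |δ.onLip f x| ≤ C * q := by
  obtain ⟨C, hC⟩ := δ.exists_bound_lipAt
  refine ⟨C, fun f => ?_⟩
  filter_upwards [hC f] with x hx q hq h
  have hcont : Tendsto (fun t : ℝ => (C : ℝ) * t) (𝓝[>] q) (𝓝 (C * q)) :=
    ((continuous_const.mul continuous_id).tendsto q).mono_left nhdsWithin_le_nhds
  refine ge_of_tendsto hcont ?_
  filter_upwards [self_mem_nhdsWithin] with t ht
  have ht : q < t := ht
  exact hx t (hq.trans ht.le) (lipAt_of_ptLip_lt (h.trans_lt
    ((ENNReal.ofReal_lt_ofReal_iff (hq.trans_lt ht)).2 ht)))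

end Derivation

end LipDiff
end

noncomputable section

namespace LipDiff

/-! ### Scaling measurable coefficients into L^∞ without changing the relations they satisfy. -/

section Normalise

variable {Y : Type*} [MeasurableSpace Y]

/-- The normalisation of a coefficient vector, with entries in `[-1, 1]`. -/
def normalise {m : ℕ} (c : Fin m → ℝ) (i : Fin m) : ℝ := c i / (1 + ∑ k, |c k|)

theorem abs_normalise_le {m : ℕ} (c : Fin m → ℝ) (i : Fin m) : |normalise c i| ≤ 1 := by
  have h : |c i| ≤ ∑ k, |c k| :=
    Finset.single_le_sum (f := fun k => |c k|) (fun _ _ => abs_nonneg _) (Finset.mem_univ i)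
  have h2 : 0 < 1 + ∑ k, |c k| := by positivity
  rw [normalise, abs_div, abs_of_pos h2, div_le_one h2]
  linarith

theorem sum_normalise_mul_eq_zero {m : ℕ} (c t : Fin m → ℝ) :
    ∑ i, normalise c i * t i = 0 ↔ ∑ i, c i * t i = 0 := by
  have h2 : (1 + ∑ k, |c k|) ≠ 0 := by positivity
  simp only [normalise, div_mul_eq_mul_div, ← Finset.sum_div, div_eq_zero_iff, h2, or_false]

/-- The normalised coefficients as elements of `L^∞`. -/
def normaliseLp {m : ℕ} (μ : Measure Y) (c : Fin m → Y → ℝ) (hc : ∀ i, Measurable (c i))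
    (i : Fin m) : Lp ℝ ∞ μ :=
  (memLp_top_of_bound (f := fun x => normalise (fun i => c i x) i) (μ := μ)
    ((hc i).div (measurable_const.add
      (Finset.measurable_fun_sum _ fun k _ => (hc k).abs))).aestronglyMeasurable 1
    (.of_forall fun x => abs_normalise_le (fun i => c i x) i)).toLp

theorem normaliseLp_ae {μ : Measure Y} {m : ℕ} (c : Fin m → Y → ℝ) (hc : ∀ i, Measurable (c i)) :
    ∀ᵐ x ∂μ, ∀ i, normaliseLp μ c hc i x = normalise (fun i => c i x) i :=
  ae_all_iff.2 fun _ => MemLp.coeFn_toLp _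

theorem integrable_top_mul {μ : Measure Y} (u : Lp ℝ ∞ μ) {φ : Y → ℝ} (hφ : Integrable φ μ) :
    Integrable (fun x => u x * φ x) μ :=
  hφ.bdd_mul (Lp.aestronglyMeasurable u) (ae_abs_le_norm_top u)

end Normalise

/-! ### Combinations of derivations with L^∞ coefficients. -/

section Combination

variable {X : Type*} [MetricSpace X] [MeasurableSpace X] {μ : Measure X}

/-- The linear map underlying a combination of derivations with coefficients in `L^∞`. -/
def lincombMap {m : ℕ} (c : Fin m → Lp ℝ ∞ μ) (d : Fin m → MetricDerivation μ) :
    LipB X →ₗ[ℝ] Lp ℝ ∞ μ :=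
  ∑ i, ((ContinuousLinearMap.mul ℝ ℝ).holderL μ ∞ ∞ ∞ (c i)).toLinearMap ∘ₗ (d i).toLinearMap

theorem lincombMap_ae {m : ℕ} (c : Fin m → Lp ℝ ∞ μ) (d : Fin m → MetricDerivation μ)
    (f : LipB X) :
    ∀ᵐ x ∂μ, lincombMap c d f x = ∑ i, c i x * (d i).toLinearMap f x := by
  have h1 : lincombMap c d f =
      ∑ i, (ContinuousLinearMap.mul ℝ ℝ).holder ∞ (c i) ((d i).toLinearMap f) := by
    simp only [lincombMap, LinearMap.sum_apply]
    rfl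
  rw [h1]
  filter_upwards [Lp.coeFn_finsetSum Finset.univ
    (fun i => (ContinuousLinearMap.mul ℝ ℝ).holder ∞ (c i) ((d i).toLinearMap f)),
    ae_all_iff.2 fun i => (ContinuousLinearMap.mul ℝ ℝ).coeFn_holder (r := ∞) (c i)
      ((d i).toLinearMap f)] with x h2 h3
  rw [h2, Finset.sum_apply]
  simp [h3]

/-- The combination `∑ i, c i • d i` of derivations with coefficients in `L^∞`. -/
def lincomb {m : ℕ} (c : Fin m → Lp ℝ ∞ μ) (d : Fin m → MetricDerivation μ) :
    MetricDerivation μ where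
  toLinearMap := lincombMap c d
  bounded := by
    choose C hC using fun i => (d i).bounded
    refine ⟨∑ i, ‖(ContinuousLinearMap.mul ℝ ℝ).holderL μ ∞ ∞ ∞ (c i)‖ * C i, fun f K hf => ?_⟩
    simp only [lincombMap, LinearMap.sum_apply]
    refine (norm_sum_le _ _).trans ?_
    rw [Finset.sum_mul]
    refine Finset.sum_le_sum fun i _ => ?_
    refine (((ContinuousLinearMap.mul ℝ ℝ).holderL μ ∞ ∞ ∞ (c i)).le_opNorm _).trans ?_
    rw [mul_assoc]
    gcongr
    exact hC i f K hf
  leibniz := by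
    intro f g
    filter_upwards [lincombMap_ae c d (f * g), lincombMap_ae c d f, lincombMap_ae c d g,
      ae_all_iff.2 fun i => (d i).leibniz f g] with x h1 h2 h3 h4
    rw [h1, h2, h3, Finset.mul_sum, Finset.mul_sum, ← Finset.sum_add_distrib]
    refine Finset.sum_congr rfl fun i _ => ?_
    rw [h4]; ring
  weakCont := by
    intro F f hF φ hφ
    -- The coefficients are absorbed into the test function, which stays integrable.
    have hint : ∀ h : LipB X, ∫ x, lincombMap c d h x * φ x ∂μ =
        ∑ i, ∫ x, (d i).toLinearMap h x * (c i x * φ x) ∂μ := by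
      intro h
      rw [← integral_finsetSum _ fun i _ => integrable_top_mul _ (integrable_top_mul _ hφ)]
      refine integral_congr_ae ?_
      filter_upwards [lincombMap_ae c d h] with x hx
      rw [hx, Finset.sum_mul]
      exact Finset.sum_congr rfl fun i _ => by ring
    simp only [hint]
    exact tendsto_finsetSum _ fun i _ => (d i).weakCont F f hF _ (integrable_top_mul _ hφ)

theorem onLip_lincomb {m : ℕ} (c : Fin m → Lp ℝ ∞ μ) (d : Fin m → MetricDerivation μ)
    (f : LipFun X) :
    ∀ᵐ x ∂μ, (lincomb c d).onLip f x = ∑ i, c i x * (d i).onLip f x := by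
  filter_upwards [ae_all_iff.2 fun k => lincombMap_ae c d (f.trunc k)] with x hx
  exact hx _

end Combination

/-! ### Derivations are determined by a generating tuple. -/

section Generation

variable {X : Type*} [MetricSpace X]

theorem lipschitzWith_cutoff (a : X) (R : ℝ) :
    LipschitzWith 1 fun x => max 0 (min 1 (R + 1 - dist x a)) :=
  (LipschitzWith.of_dist_le_mul fun x y => by
      rw [Real.dist_eq, NNReal.coe_one, one_mul,
        show R + 1 - dist x a - (R + 1 - dist y a) = dist y a - dist x a by ring, dist_comm x y]
      exact abs_dist_sub_le y x a).const_min _ |>.const_max _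

/-- The distance cutoff equal to `1` on `ball a R` and to `0` off `ball a (R + 1)`. -/
def cutoff (a : X) (R : ℝ) : LipB X :=
  LipB.mk (fun x => max 0 (min 1 (R + 1 - dist x a))) 1 1
    (lipschitzWith_cutoff a R)
    (fun x => by
      rw [abs_of_nonneg (le_max_left _ _)]
      simp)

theorem cutoff_eq_one {a : X} {R : ℝ} {x : X} (h : x ∈ Metric.ball a R) :
    (cutoff a R : X → ℝ) x = 1 := by
  have := Metric.mem_ball.1 h
  change max (0 : ℝ) (min 1 (R + 1 - dist x a)) = 1
  rw [min_eq_left (by linarith)]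
  simp

theorem cutoff_eq_zero {a : X} {R : ℝ} {x : X} (h : x ∉ Metric.ball a (R + 1)) :
    (cutoff a R : X → ℝ) x = 0 := by
  rw [Metric.mem_ball, not_lt] at h
  change max (0 : ℝ) (min 1 (R + 1 - dist x a)) = 0
  exact max_eq_left ((min_le_right _ _).trans (by linarith))

theorem cutoff_mem (a : X) (R : ℝ) (x : X) :
    0 ≤ (cutoff a R : X → ℝ) x ∧ (cutoff a R : X → ℝ) x ≤ 1 :=
  ⟨le_max_left _ _, max_le zero_le_one (min_le_left _ _)⟩

theorem cutoff_dist_le (a : X) (R : ℝ) (x y : X) :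
    |(cutoff a R : X → ℝ) x - (cutoff a R : X → ℝ) y| ≤ dist x y := by
  have h := (lipschitzWith_cutoff a R).dist_le_mul x y
  rwa [Real.dist_eq, NNReal.coe_one, one_mul] at h

/-- Inside the ball this is the product estimate. Nothing is known about `p` outside, but if one of
the two points lies there, the cutoff at the other is at most their distance. -/
theorem lipNormLE_cutoff_mul {a : X} {R : ℝ} {p : X → ℝ} {K : ℝ≥0}
    (hp : LipNormLE (Metric.ball a (R + 1)) p K) :
    LipNormLE univ (fun x => (cutoff a R : X → ℝ) x * p x) (2 * K) := by
  have hb : ∀ x, |(cutoff a R : X → ℝ) x * p x| ≤ K * (cutoff a R : X → ℝ) x := by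
    intro x
    by_cases hx : x ∈ Metric.ball a (R + 1)
    · rw [abs_mul, abs_of_nonneg (cutoff_mem a R x).1, mul_comm]
      exact mul_le_mul_of_nonneg_right (hp.2 x hx) (cutoff_mem a R x).1
    · simp [cutoff_eq_zero hx]
  have hside : ∀ x y, y ∉ Metric.ball a (R + 1) →
      |(cutoff a R : X → ℝ) x * p x| ≤ 2 * K * dist x y := by
    intro x y hy
    have h1 := cutoff_dist_le a R x y
    rw [cutoff_eq_zero hy, sub_zero] at h1
    have h2 := (hb x).trans (mul_le_mul_of_nonneg_left ((le_abs_self _).trans h1) K.2)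
    have h3 : 0 ≤ (K : ℝ) * dist x y := by positivity
    linarith
  refine ⟨LipschitzOnWith.of_dist_le_mul fun x _ y _ => ?_, fun x _ => ?_⟩
  · rw [Real.dist_eq]
    push_cast
    by_cases hy : y ∈ Metric.ball a (R + 1)
    · by_cases hx : x ∈ Metric.ball a (R + 1)
      · have h1 := hp.1.dist_le_mul x hx y hy
        rw [Real.dist_eq] at h1
        rw [show (cutoff a R : X → ℝ) x * p x - (cutoff a R : X → ℝ) y * p y =
          (cutoff a R : X → ℝ) x * (p x - p y) +
            ((cutoff a R : X → ℝ) x - (cutoff a R : X → ℝ) y) * p y by ring]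
        refine (abs_add_le _ _).trans ?_
        rw [abs_mul, abs_mul, abs_of_nonneg (cutoff_mem a R x).1]
        have h2 := mul_le_mul (cutoff_mem a R x).2 h1 (abs_nonneg _) zero_le_one
        have h3 := mul_le_mul (cutoff_dist_le a R x y) (hp.2 y hy) (abs_nonneg _) dist_nonneg
        linarith
      · rw [cutoff_eq_zero hx, zero_mul, zero_sub, abs_neg, dist_comm]
        exact hside y x hx
    · rw [cutoff_eq_zero hy, zero_mul, sub_zero]
      exact hside x y hy
  · refine (hb x).trans ?_
    push_cast
    have h1 := mul_le_mul_of_nonneg_left (cutoff_mem a R x).2 K.coe_nonneg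
    have h2 := K.coe_nonneg
    linarith

theorem LipB.aeval_apply {n : ℕ} (h : Fin n → LipB X) (p : MvPolynomial (Fin n) ℝ) (x : X) :
    (MvPolynomial.aeval h p : X → ℝ) x = MvPolynomial.eval (fun i => (h i : X → ℝ) x) p := by
  have h1 : ((Pi.evalAlgHom ℝ (fun _ : X => ℝ) x).comp (LipB X).val)
      (MvPolynomial.aeval h p) = MvPolynomial.aeval (fun i => (h i : X → ℝ) x) p := by
    rw [← AlgHom.comp_apply, MvPolynomial.comp_aeval]
    rfl

  exact h1

variable [MeasurableSpace X] {μ : Measure X}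

theorem MetricDerivation.aeval_eq_zero (δ : MetricDerivation μ) {n : ℕ} {h : Fin n → LipB X}
    {s : Set X} (hh : ∀ j, ∀ᵐ x ∂μ, x ∈ s → δ.toLinearMap (h j) x = 0)
    (p : MvPolynomial (Fin n) ℝ) :
    ∀ᵐ x ∂μ, x ∈ s → δ.toLinearMap (MvPolynomial.aeval h p) x = 0 := by
  induction p using MvPolynomial.induction_on with
  | C a =>
    rw [MvPolynomial.aeval_C, Algebra.algebraMap_eq_smul_one, map_smul]
    filter_upwards [δ.map_one, Lp.coeFn_smul a (δ.toLinearMap 1)] with x h1 h2 _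
    rw [h2, Pi.smul_apply, h1, smul_zero]
  | add p q hp hq =>
    rw [map_add, map_add]
    filter_upwards [hp, hq, Lp.coeFn_add (δ.toLinearMap (MvPolynomial.aeval h p))
      (δ.toLinearMap (MvPolynomial.aeval h q))] with x h1 h2 h3 hx
    rw [h3, Pi.add_apply, h1 hx, h2 hx, add_zero]
  | mul_X p i hp =>
    rw [map_mul, MvPolynomial.aeval_X]
    filter_upwards [hp, hh i, δ.leibniz (MvPolynomial.aeval h p) (h i)] with x h1 h2 h3 hx
    rw [h3, h1 hx, h2 hx, mul_zero, mul_zero, add_zero]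

variable [BorelSpace X] [SigmaFinite μ]

/-- A derivation that annihilates a generating tuple vanishes. -/
theorem MetricDerivation.eq_zero_of_generates (δ : MetricDerivation μ) {n : ℕ}
    {g : Fin n → LipFun X} (hg : Generates g) (h0 : ∀ j, ∀ᵐ x ∂μ, δ.onLip (g j) x = 0)
    (f : LipB X) : ∀ᵐ x ∂μ, δ.toLinearMap f x = 0 := by
  rcases isEmpty_or_nonempty X with hX | ⟨⟨a⟩⟩
  · exact .of_forall fun x => isEmptyElim x
  have key : ∀ R : ℕ, ∀ᵐ x ∂μ, x ∈ Metric.ball a (R : ℝ) → δ.toLinearMap f x = 0 := by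
    intro R
    obtain ⟨p, hp1, K, hpK⟩ := hg a (R + 1) f
    -- The g_j are bounded on the larger ball, so truncation at `m` leaves them unchanged there and
    -- places polynomials in them in Lip_b(X).
    obtain ⟨m, hm⟩ : ∃ m : ℕ, ∀ j, ∀ x ∈ Metric.ball a ((R : ℝ) + 1), |g j x| ≤ m := by
      choose L hL using fun j => (g j).2
      obtain ⟨m, hm⟩ := exists_nat_ge (∑ j, (|g j a| + L j * (R + 1)))
      refine ⟨m, fun j x hx => le_trans ?_ hm⟩
      refine le_trans ?_ (Finset.single_le_sum (f := fun j => |g j a| + L j * ((R : ℝ) + 1))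
        (fun j _ => by positivity) (Finset.mem_univ j))
      have h1 := (hL j).dist_le_mul x a
      rw [Real.dist_eq] at h1
      have h2 : (L j : ℝ) * dist x a ≤ L j * (R + 1) :=
        mul_le_mul_of_nonneg_left (Metric.mem_ball.1 hx).le (L j).2
      have h3 := abs_sub_abs_le_abs_sub (g j x) (g j a)
      change |g j x| ≤ |g j a| + L j * ((R : ℝ) + 1)
      linarith
    set h : Fin n → LipB X := fun j => (g j).trunc m with hh
    have hval : ∀ k, ∀ x ∈ Metric.ball a ((R : ℝ) + 1), (MvPolynomial.aeval h (p k) : X → ℝ) x =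
        MvPolynomial.eval (fun i => g i x) (p k) := by
      intro k x hx
      rw [LipB.aeval_apply]
      congr 2
      funext i
      exact LipFun.trunc_eq (hm i x hx)
    have hδ : ∀ j, ∀ᵐ x ∂μ, x ∈ Metric.ball a (R : ℝ) → δ.toLinearMap (h j) x = 0 := by
      intro j
      filter_upwards [h0 j, δ.onLip_eq (g j) (h j) 0] with x h1 h2 hx
      rw [← h2, h1]
      rw [add_zero]
      exact (LipFun.trunc_eq (hm j x (Metric.ball_subset_ball (by linarith) hx))).symm
    have hcut : ∀ᵐ x ∂μ, x ∈ Metric.ball a (R : ℝ) → δ.toLinearMap (cutoff a R) x = 0 := by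
      filter_upwards [δ.locality (cutoff a R) 0 1, Lp.coeFn_zero ℝ ∞ μ] with x h1 h2 hx
      rw [h1 (by rw [cutoff_eq_one hx]; simp), map_zero, h2, Pi.zero_apply]
    -- The polynomials converge only on the ball of radius `R + 1`; the cutoff vanishes off it and
    -- equals 1 on the ball of radius `R`, where `f` is recovered by locality.
    have hconv : LipWeakStar univ
        (fun k => ((cutoff a R * MvPolynomial.aeval h (p k) : LipB X) : X → ℝ))
        (cutoff a R * f : LipB X) := by
      refine ⟨fun x _ => ?_, 2 * K, fun k => ?_⟩
      · change Tendsto (fun k => (cutoff a R : X → ℝ) x * (MvPolynomial.aeval h (p k) : X → ℝ) x)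
          atTop (𝓝 ((cutoff a R : X → ℝ) x * (f : X → ℝ) x))
        by_cases hx : x ∈ Metric.ball a ((R : ℝ) + 1)
        · simp only [hval _ x hx]
          exact (hp1 x hx).const_mul _
        · simp only [cutoff_eq_zero hx, zero_mul]
          exact tendsto_const_nhds
      · refine lipNormLE_cutoff_mul ⟨?_, fun x hx => ?_⟩
        · intro x hx y hy
          rw [hval k x hx, hval k y hy]
          exact (hpK k).1 hx hy
        · rw [hval k x hx]
          exact (hpK k).2 x hx
    have hlim := δ.eq_zero_of_lipWeakStar hconv (s := Metric.ball a (R : ℝ))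
      Metric.isOpen_ball.measurableSet fun k => by
        filter_upwards [hcut, δ.aeval_eq_zero hδ (p k),
          δ.leibniz (cutoff a R) (MvPolynomial.aeval h (p k))] with x h1 h2 h3 hx
        rw [h3, h1 hx, h2 hx, mul_zero, mul_zero, add_zero]
    filter_upwards [hlim, δ.locality f (cutoff a R * f) 0] with x h1 h2 hx
    rw [h2, h1 hx]
    change (f : X → ℝ) x = (cutoff a R : X → ℝ) x * (f : X → ℝ) x + 0
    rw [cutoff_eq_one hx, one_mul, add_zero]
  filter_upwards [ae_all_iff.2 key] with x hx
  obtain ⟨R, hR⟩ := exists_nat_gt (dist x a)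
  exact hx R hR

/-- Measurable coefficients may be unbounded; the normalised combination is a genuine derivation
annihilating `g`. -/
theorem lincomb_normaliseLp_eq_zero {m n : ℕ} {g : Fin n → LipFun X} (hg : Generates g)
    (d : Fin m → MetricDerivation μ) {c : Fin m → X → ℝ} (hc : ∀ i, Measurable (c i))
    (h0 : ∀ j, ∀ᵐ x ∂μ, ∑ i, c i x * (d i).onLip (g j) x = 0) (f : LipB X) :
    ∀ᵐ x ∂μ, (lincomb (normaliseLp μ c hc) d).toLinearMap f x = 0 :=
  (lincomb (normaliseLp μ c hc) d).eq_zero_of_generates hg (fun j => by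
    filter_upwards [onLip_lincomb (normaliseLp μ c hc) d (g j), h0 j, normaliseLp_ae c hc]
      with x h1 h2 h3
    rw [h1]
    simp only [h3]
    exact (sum_normalise_mul_eq_zero _ _).2 h2) f

theorem sum_onLip_eq_zero_of_generates {m n : ℕ} {g : Fin n → LipFun X} (hg : Generates g)
    (d : Fin m → MetricDerivation μ) {c : Fin m → X → ℝ} (hc : ∀ i, Measurable (c i))
    (h0 : ∀ j, ∀ᵐ x ∂μ, ∑ i, c i x * (d i).onLip (g j) x = 0) (f : LipFun X) :
    ∀ᵐ x ∂μ, ∑ i, c i x * (d i).onLip f x = 0 := by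
  have h1 := lincomb_normaliseLp_eq_zero hg d hc h0
  filter_upwards [onLip_lincomb (normaliseLp μ c hc) d f, normaliseLp_ae c hc,
    ae_all_iff.2 fun k => h1 (f.trunc k)] with x h2 h3 h4
  rw [← sum_normalise_mul_eq_zero]
  simp only [h3] at h2
  rw [← h2]
  exact h4 _

/-- A linearly independent tuple admits no nontrivial relation with measurable coefficients on
a generating tuple. -/
theorem LinIndep.coeff_eq_zero {m n : ℕ} {g : Fin n → LipFun X} (hg : Generates g)
    {d : Fin m → MetricDerivation μ} (hd : LinIndep d) {c : Fin m → X → ℝ}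
    (hc : ∀ i, Measurable (c i))
    (h0 : ∀ j, ∀ᵐ x ∂μ, ∑ i, c i x * (d i).onLip (g j) x = 0) :
    ∀ᵐ x ∂μ, ∀ i, c i x = 0 := by
  have h1 := lincomb_normaliseLp_eq_zero hg d hc h0
  have h2 := hd (normaliseLp μ c hc) fun f => by
    filter_upwards [h1 f, lincombMap_ae (normaliseLp μ c hc) d f] with x h3 h4
    rw [← h4]
    exact h3
  filter_upwards [normaliseLp_ae c hc, Lp.coeFn_zero ℝ ∞ μ] with x h3 h4 i
  have h5 := h3 i
  rw [h2 i, h4, Pi.zero_apply] at h5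
  have h6 : (1 + ∑ k, |c k x|) ≠ 0 := by positivity
  rw [normalise, eq_comm, div_eq_zero_iff] at h5
  exact h5.resolve_right h6

end Generation

end LipDiff
end

noncomputable section

namespace LipDiff

/-! ### From measurable relations to pointwise linear independence. -/

section MatrixMeasurability

variable {Y : Type*} [MeasurableSpace Y] {n : ℕ} {A : Y → Matrix (Fin n) (Fin n) ℝ}

theorem measurable_det (hA : ∀ i j, Measurable fun x => A x i j) :
    Measurable fun x => (A x).det := by
  simp only [Matrix.det_apply]
  exact Finset.measurable_fun_sum _ fun σ _ =>
    (Finset.measurable_fun_prod _ fun i _ => hA (σ i) i).const_smul _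

theorem measurable_adjugate (hA : ∀ i j, Measurable fun x => A x i j) (i j : Fin n) :
    Measurable fun x => (A x).adjugate i j := by
  simp only [Matrix.adjugate_apply]
  refine measurable_det fun k l => ?_
  simp only [Matrix.updateRow_apply]
  by_cases h : k = j
  · simp [h]
  · simpa [h] using hA k l

theorem measurable_inv (hA : ∀ i j, Measurable fun x => A x i j) (i j : Fin n) :
    Measurable fun x => (A x)⁻¹ i j := by
  simp only [Matrix.inv_def, Ring.inverse_eq_inv, Matrix.smul_apply, smul_eq_mul]
  exact (measurable_det hA).inv.mul (measurable_adjugate hA i j)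

/-- If measurable vector fields admit no nontrivial relation with measurable coefficients, they
are pointwise linearly independent almost everywhere. -/
theorem ae_linearIndependent {μ : Measure Y} {m : ℕ} (ρ : Fin m → Y → EuclideanSpace ℝ (Fin n))
    (hρ : ∀ i j, Measurable fun x => ρ i x j)
    (h : ∀ c : Fin m → Y → ℝ, (∀ i, Measurable (c i)) →
      (∀ j, ∀ᵐ x ∂μ, ∑ i, c i x * ρ i x j = 0) → ∀ᵐ x ∂μ, ∀ i, c i x = 0) :
    ∀ᵐ x ∂μ, LinearIndependent ℝ fun i => ρ i x := by
  induction m with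
  | zero => exact .of_forall fun x => linearIndependent_empty_type
  | succ m ih =>
    have htail := ih (fun i => ρ i.succ) (fun i j => hρ i.succ j) fun c hc h0 => by
      have h1 := h (Fin.cons 0 c) (fun i => by
        refine Fin.cases ?_ (fun i => ?_) i
        · exact measurable_const
        · exact hc i) fun j => by
          filter_upwards [h0 j] with x hx
          rw [Fin.sum_univ_succ]
          simpa using hx
      filter_upwards [h1] with x hx i
      exact hx i.succ
    set G : Y → Matrix (Fin m) (Fin m) ℝ := fun x => Matrix.gram ℝ fun i : Fin m => ρ i.succ x
      with hG
    set b : Fin m → Y → ℝ := fun i x => inner ℝ (ρ i.succ x) (ρ 0 x) with hb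
    have hinner : ∀ i k, Measurable fun x => (inner ℝ (ρ i x) (ρ k x) : ℝ) := fun i k => by
      simp only [PiLp.inner_apply]
      exact Finset.measurable_fun_sum _ fun j _ => (hρ k j).mul (hρ i j)
    have hGm : ∀ i k, Measurable fun x => G x i k := fun i k => hinner i.succ k.succ
    -- The solution of the normal equations: an explicit, hence measurable, choice of the only
    -- coefficients that can express `ρ 0 x` through the independent tail. On the set `S` where they
    -- do, (-1, a) is a measurable relation, so `S` is null.
    set a : Fin m → Y → ℝ := fun i x => ∑ k, (G x)⁻¹ i k * b k x with ha
    have ham : ∀ i, Measurable (a i) := fun i =>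
      Finset.measurable_fun_sum _ fun k _ => (measurable_inv hGm i k).mul (hinner k.succ 0)
    set S : Set Y := {x | ∀ j, ρ 0 x j = ∑ i : Fin m, a i x * ρ i.succ x j} with hS
    have hSm : MeasurableSet S := by
      rw [hS, ofPred_forall]
      exact MeasurableSet.iInter fun j => measurableSet_eq_fun (hρ 0 j)
        (Finset.measurable_fun_sum _ fun i _ => (ham i).mul (hρ i.succ j))
    have hc := h (fun i => S.indicator ((Fin.cons (fun _ => -1) a : Fin (m + 1) → Y → ℝ) i))
      (fun i => by
        refine Measurable.indicator ?_ hSm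
        refine Fin.cases ?_ (fun i => ?_) i
        · exact measurable_const
        · exact ham i)
      fun j => .of_forall fun x => by
        by_cases hx : x ∈ S
        · rw [Fin.sum_univ_succ]
          simp only [indicator_of_mem hx, Fin.cons_zero, Fin.cons_succ]
          rw [hx j]; ring
        · simp [hx]
    filter_upwards [hc, htail] with x hx hli
    have hxS : x ∉ S := fun hxS => by
      have := hx 0
      simp [hxS] at this
    have h1 : (fun i => ρ i x) =
        (Fin.cons (ρ 0 x) (fun i : Fin m => ρ i.succ x) : Fin (m + 1) → _) := by
      funext i
      refine Fin.cases rfl (fun i => rfl) i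
    rw [h1, linearIndependent_finCons]
    refine ⟨hli, fun hspan => hxS ?_⟩
    obtain ⟨w, hw⟩ := (Submodule.mem_span_range_iff_exists_fun ℝ).1 hspan
    have hdet : IsUnit (G x).det :=
      (Matrix.posDef_gram_of_linearIndependent hli).det_pos.ne'.isUnit
    have hbw : (fun i => b i x) = G x *ᵥ w := by
      funext i
      simp only [hb, hG, ← hw, Matrix.mulVec, dotProduct, Matrix.gram_apply, inner_sum,
        real_inner_smul_right]
      exact Finset.sum_congr rfl fun k _ => mul_comm _ _
    have haw : ∀ i, a i x = w i := fun i => by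
      have : (fun i => a i x) = (G x)⁻¹ *ᵥ fun i => b i x := rfl
      rw [hbw, Matrix.mulVec_mulVec, Matrix.nonsing_inv_mul _ hdet, Matrix.one_mulVec] at this
      exact congrFun this i
    intro j
    have := congrArg (fun v : EuclideanSpace ℝ (Fin n) => v j) hw
    simp only [haw]
    rw [← this]
    simp

end MatrixMeasurability

/-! ### Invertibility of the Jacobi matrix and the chain rule. -/

section Jacobi

variable {X : Type*} [MetricSpace X] [MeasurableSpace X] [BorelSpace X] {μ : Measure X}

theorem measurable_jacobi {n : ℕ} (e : Fin n → MetricDerivation μ) (g : Fin n → LipFun X)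
    (i j : Fin n) : Measurable fun x => jacobi e g x i j :=
  (e i).measurable_onLip (g j)

variable [SigmaFinite μ]

/-- `LinIndep.coeff_eq_zero` excludes measurable relations between the rows, and
`ae_linearIndependent` turns this into independence at almost every point. -/
theorem LinIndep.ae_isUnit_det_jacobi {n : ℕ} {g : Fin n → LipFun X} (hg : Generates g)
    {e : Fin n → MetricDerivation μ} (he : LinIndep e) :
    ∀ᵐ x ∂μ, IsUnit (jacobi e g x).det := by
  have h := ae_linearIndependent (μ := μ)
    (fun i x => (WithLp.toLp 2 (jacobi e g x i) : EuclideanSpace ℝ (Fin n)))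
    (measurable_jacobi e g) fun c hc h0 => he.coeff_eq_zero hg hc h0
  filter_upwards [h] with x hx
  have h1 := hx.map' (WithLp.linearEquiv 2 ℝ (Fin n → ℝ)).toLinearMap (LinearEquiv.ker _)
  exact (Matrix.isUnit_iff_isUnit_det _).1 (Matrix.linearIndependent_rows_iff_isUnit.1 h1)

/-- The candidate `(eg)⁻¹ ef` for the differential of `f`. -/
def diff {n : ℕ} (e : Fin n → MetricDerivation μ) (g : Fin n → LipFun X) (f : LipFun X) (x : X) :
    EuclideanSpace ℝ (Fin n) :=
  WithLp.toLp 2 ((jacobi e g x)⁻¹ *ᵥ fun i => (e i).onLip f x)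

/-- The chain rule: every derivation acts on `f` through the candidate differential. -/
theorem MetricDerivation.onLip_eq_sum_diff {n : ℕ} {g : Fin n → LipFun X} (hg : Generates g)
    {e : Fin n → MetricDerivation μ} (he : LinIndep e) (δ : MetricDerivation μ) (f : LipFun X) :
    ∀ᵐ x ∂μ, δ.onLip f x = ∑ j, diff e g f x j * δ.onLip (g j) x := by
  -- Chosen so that δ - Σ a_i e_i annihilates every g_j.
  set a : Fin n → X → ℝ := fun i x => ((fun j => δ.onLip (g j) x) ᵥ* (jacobi e g x)⁻¹) i with ha
  have ham : ∀ i, Measurable (a i) := fun i => by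
    simp only [ha, Matrix.vecMul, dotProduct]
    exact Finset.measurable_fun_sum _ fun k _ =>
      (δ.measurable_onLip (g k)).mul (measurable_inv (measurable_jacobi e g) k i)
  have hker := sum_onLip_eq_zero_of_generates hg (Fin.cons δ e : Fin (n + 1) → _)
    (c := (Fin.cons (fun _ => -1) a : Fin (n + 1) → X → ℝ)) (fun i => by
      refine Fin.cases ?_ (fun i => ?_) i
      · exact measurable_const
      · exact ham i) (fun j => by
      filter_upwards [he.ae_isUnit_det_jacobi hg] with x hx
      have h1 : (fun i => a i x) ᵥ* jacobi e g x = fun j => δ.onLip (g j) x := by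
        change ((fun j => δ.onLip (g j) x) ᵥ* (jacobi e g x)⁻¹) ᵥ* jacobi e g x = _
        rw [Matrix.vecMul_vecMul, Matrix.nonsing_inv_mul _ hx, Matrix.vecMul_one]
      have h2 : ∑ i, a i x * (e i).onLip (g j) x = δ.onLip (g j) x := congrFun h1 j
      rw [Fin.sum_univ_succ]
      simp only [Fin.cons_zero, Fin.cons_succ]
      rw [h2]; ring) f
  filter_upwards [hker] with x hx
  rw [Fin.sum_univ_succ] at hx
  simp only [Fin.cons_zero, Fin.cons_succ] at hx
  have h3 : δ.onLip f x = (fun i => a i x) ⬝ᵥ fun i => (e i).onLip f x := by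
    simp only [dotProduct]; linarith
  rw [h3]
  change ((fun j => δ.onLip (g j) x) ᵥ* (jacobi e g x)⁻¹) ⬝ᵥ (fun i => (e i).onLip f x) = _
  rw [← Matrix.dotProduct_mulVec, dotProduct_comm]
  rfl

end Jacobi

end LipDiff
end

noncomputable section

namespace LipDiff

/-! ### Existence and uniqueness of differentials, charts and the scalar basis. -/

section Differential

variable {X : Type*} [MetricSpace X]

/-- Continuity in the vector: it transfers a.e. estimates from a countable dense set of vectors to
vectors that depend on the point. -/
theorem ptLip_subInner_le (f : LipFun X) {n : ℕ} {g : Fin n → LipFun X} {L : ℝ≥0}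
    (hL : LipschitzWith L (coords g)) (u v : EuclideanSpace ℝ (Fin n)) {x : X} {p : ℝ}
    (hp : 0 ≤ p) (h : ptLip (f.subInner g u).1 x ≤ ENNReal.ofReal p) :
    ptLip (f.subInner g v).1 x ≤ ENNReal.ofReal (p + ‖u - v‖ * L) := by
  have h1 := ptLip_le_add hp (NNReal.coe_nonneg _) h
    (lipAt_of_lipschitzWith (lipschitzWith_inner_coords hL (u - v)) x)
  have h2 : (f.subInner g v).1 =
      fun y => (f.subInner g u).1 y + inner ℝ (u - v) (coords g y) := by
    funext y
    change f y - inner ℝ v (coords g y) =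
      f y - inner ℝ u (coords g y) + inner ℝ (u - v) (coords g y)
    rw [inner_sub_left]; ring
  rw [h2]
  simpa using h1

variable [MeasurableSpace X] [BorelSpace X] {μ : Measure X}

theorem measurable_diff {n : ℕ} (e : Fin n → MetricDerivation μ) (g : Fin n → LipFun X)
    (f : LipFun X) : Measurable (diff e g f) := by
  refine (WithLp.measurable_toLp 2 _).comp (measurable_pi_iff.2 fun i => ?_)
  simp only [Matrix.mulVec, dotProduct]
  exact Finset.measurable_fun_sum _ fun k _ =>
    (measurable_inv (measurable_jacobi e g) i k).mul ((e k).measurable_onLip f)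

variable [SigmaFinite μ]

/-- The vector v(x) varies with `x`, so the Lip-derivation inequality cannot be applied to f - v·g
directly. It is applied to constant vectors from a dense sequence, and the resulting bound `Φ` is
continuous and vanishes at v(x). -/
theorem ae_isDifferentialAt_diff (hLD : LipDerivationInequality μ) {n : ℕ}
    {g : Fin n → LipFun X} (hg : Generates g) {e : Fin n → MetricDerivation μ} (he : LinIndep e)
    (f : LipFun X) : ∀ᵐ x ∂μ, IsDifferentialAt (coords g) f x (diff e g f x) := by
  obtain ⟨m, d, -, K, hK, hd⟩ := hLD
  obtain ⟨L, hL⟩ := exists_lipschitzWith_coords g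
  set u := TopologicalSpace.denseSeq (EuclideanSpace ℝ (Fin n)) with hu
  filter_upwards [ae_all_iff.2 fun k => hd (f.subInner g (u k)),
    ae_all_iff.2 fun k => ae_all_iff.2 fun i => (d i).onLip_subInner f g (u k),
    ae_all_iff.2 fun i => (d i).onLip_eq_sum_diff hg he f] with x h1 h2 h3
  set v := diff e g f x with hv
  set Φ : EuclideanSpace ℝ (Fin n) → ℝ := fun w =>
    K * ‖(WithLp.toLp 2 fun i => ∑ j, (v j - w j) * (d i).onLip (g j) x :
      EuclideanSpace ℝ (Fin m))‖ + ‖w - v‖ * L with hΦ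
  have hΦc : Continuous Φ := by fun_prop
  have key : ∀ w, ptLip (f.subInner g v).1 x ≤ ENNReal.ofReal (Φ w) := by
    intro w
    refine (TopologicalSpace.denseRange_denseSeq _).induction_on
      (p := fun w => ptLip (f.subInner g v).1 x ≤ ENNReal.ofReal (Φ w)) w
      (isClosed_le continuous_const (ENNReal.continuous_ofReal.comp hΦc)) fun k => ?_
    refine ptLip_subInner_le f hL (u k) v (by positivity) ((h1 k).2.trans (le_of_eq ?_))
    congr 4
    funext i
    rw [h2 k i, h3 i, ← Finset.sum_sub_distrib]
    exact Finset.sum_congr rfl fun j _ => by ring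
  have h4 := key v
  have h5 : Φ v = 0 := by
    simp only [hΦ, sub_self, zero_mul, Finset.sum_const_zero, norm_zero, add_zero]
    have : (WithLp.toLp 2 (fun _ : Fin m => (0 : ℝ)) : EuclideanSpace ℝ (Fin m)) = 0 := rfl
    rw [this, norm_zero, mul_zero]
  rw [h5, ENNReal.ofReal_zero] at h4
  exact le_antisymm h4 zero_le

variable [TopologicalSpace.SeparableSpace X]

/-- Every e_i is controlled by Lip a.e., so Lip[f - v·g](x) = 0 forces (eg)v = ef at `x`. A dense
sequence again makes the null set independent of `v`. -/
theorem ae_eq_diff_of_isDifferentialAt {n : ℕ} {g : Fin n → LipFun X} (hg : Generates g)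
    {e : Fin n → MetricDerivation μ} (he : LinIndep e) (f : LipFun X) :
    ∀ᵐ x ∂μ, ∀ v, IsDifferentialAt (coords g) f x v → v = diff e g f x := by
  obtain ⟨L, hL⟩ := exists_lipschitzWith_coords g
  choose C hC using fun i => (e i).exists_bound_ptLip
  set u := TopologicalSpace.denseSeq (EuclideanSpace ℝ (Fin n)) with hu
  filter_upwards [ae_all_iff.2 fun k => ae_all_iff.2 fun i => hC i (f.subInner g (u k)),
    ae_all_iff.2 fun k => ae_all_iff.2 fun i => (e i).onLip_subInner f g (u k),
    he.ae_isUnit_det_jacobi hg] with x h1 h2 h3 v hv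
  have key : ∀ i w, |(e i).onLip f x - ∑ j, w j * (e i).onLip (g j) x| ≤
      C i * (‖v - w‖ * L) := by
    intro i w
    refine (TopologicalSpace.denseRange_denseSeq _).induction_on
      (p := fun w => |(e i).onLip f x - ∑ j, w j * (e i).onLip (g j) x| ≤ C i * (‖v - w‖ * L)) w
      (isClosed_le (by fun_prop) (by fun_prop)) fun k => ?_
    rw [← h2 k i]
    refine h1 k i _ (by positivity) ?_
    have h4 : ptLip (f.subInner g v).1 x ≤ ENNReal.ofReal 0 := by
      rw [ENNReal.ofReal_zero]; exact le_of_eq hv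
    simpa using ptLip_subInner_le f hL v (u k) le_rfl h4
  have h5 : jacobi e g x *ᵥ v.ofLp = fun i => (e i).onLip f x := by
    funext i
    have h6 := key i v
    rw [sub_self, norm_zero, zero_mul, mul_zero] at h6
    have h7 := sub_eq_zero.1 (abs_nonpos_iff.1 h6)
    rw [h7]
    change ∑ j, (e i).onLip (g j) x * v j = _
    exact Finset.sum_congr rfl fun j _ => mul_comm ((e i).onLip (g j) x) (v j)
  rw [diff, ← h5, Matrix.mulVec_mulVec, Matrix.nonsing_inv_mul _ h3, Matrix.one_mulVec]

theorem exists_ae_abs_onLip_le (δ : MetricDerivation μ) (f : LipFun X) :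
    ∃ C : ℝ, 0 ≤ C ∧ ∀ᵐ x ∂μ, |δ.onLip f x| ≤ C := by
  obtain ⟨C, hC⟩ := δ.exists_bound_lipAt
  obtain ⟨K, hK⟩ := f.2
  refine ⟨C * K, by positivity, ?_⟩
  filter_upwards [hC f] with x hx
  exact hx K K.2 (lipAt_of_lipschitzWith hK x)

theorem memLp_diff {n : ℕ} (e : Fin n → MetricDerivation μ) (g : Fin n → LipFun X)
    (f : LipFun X) {Y : Set X} {C : ℝ}
    (hC : ∀ᵐ x ∂(μ.restrict Y), ∀ i j, |(jacobi e g x)⁻¹ i j| ≤ C) :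
    MemLp (diff e g f) ∞ (μ.restrict Y) := by
  refine MemLp.of_eval_piLp fun i => ?_
  choose B hB0 hB using fun k => exists_ae_abs_onLip_le (e k) f
  refine memLp_top_of_bound ?_ (∑ k, C * B k) ?_
  · exact ((EuclideanSpace.proj (𝕜 := ℝ) i).continuous.measurable.comp
      (measurable_diff e g f)).aestronglyMeasurable
  · filter_upwards [hC, ae_restrict_of_ae (ae_all_iff.2 hB)] with x h1 h2
    change ‖∑ k, (jacobi e g x)⁻¹ i k * (e k).onLip f x‖ ≤ _
    refine (norm_sum_le _ _).trans (Finset.sum_le_sum fun k _ => ?_)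
    rw [norm_mul]
    exact mul_le_mul (h1 i k) (h2 k) (norm_nonneg _) ((abs_nonneg _).trans (h1 i k))

theorem isChart_of_inv_jacobi_bounded (hLD : LipDerivationInequality μ) {n : ℕ}
    {g : Fin n → LipFun X} (hg : Generates g) {e : Fin n → MetricDerivation μ} (he : LinIndep e)
    {Y : Set X} (hY : NullMeasurableSet Y μ) (hY0 : 0 < μ Y)
    (hC : ∃ C : ℝ, ∀ᵐ x ∂(μ.restrict Y), ∀ i j, |(jacobi e g x)⁻¹ i j| ≤ C) :
    IsChart μ Y (coords g) := by
  obtain ⟨C, hC⟩ := hC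
  refine ⟨hY, hY0, exists_lipschitzWith_coords g, fun f => ?_⟩
  have hm := memLp_diff e g f hC
  refine ⟨hm.toLp, ?_, fun D hD => ?_⟩
  · filter_upwards [hm.coeFn_toLp, ae_restrict_of_ae (ae_isDifferentialAt_diff hLD hg he f)]
      with x h1 h2
    rw [h1]; exact h2
  · refine Lp.ext ?_
    filter_upwards [hm.coeFn_toLp, hD,
      ae_restrict_of_ae (ae_eq_diff_of_isDifferentialAt hg he f)] with x h1 h2 h3
    rw [h1]
    exact h3 _ h2

theorem exists_atlas (hμ : μ ≠ 0) (hLD : LipDerivationInequality μ) {n : ℕ}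
    {g : Fin n → LipFun X} (hg : Generates g) {e : Fin n → MetricDerivation μ}
    (he : LinIndep e) : ∃ Y : ℕ → Set X, IsAtlas μ Y (fun _ => n) (fun _ => coords g) := by
  set S : ℕ → Set X := fun m => {x | ∀ i j, |(jacobi e g x)⁻¹ i j| ≤ m} with hS
  have hSm : ∀ m, MeasurableSet (S m) := fun m => by
    simp only [hS, ofPred_forall]
    exact MeasurableSet.iInter fun i => MeasurableSet.iInter fun j =>
      measurableSet_le (measurable_inv (measurable_jacobi e g) i j).abs measurable_const
  have hcover : ⋃ m, S m = univ := by
    refine eq_univ_of_forall fun x => mem_iUnion.2 ?_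
    obtain ⟨m, hm⟩ := exists_nat_ge (∑ i, ∑ j, |(jacobi e g x)⁻¹ i j|)
    refine ⟨m, fun i j => le_trans ?_ hm⟩
    exact (Finset.single_le_sum (f := fun j => |(jacobi e g x)⁻¹ i j|)
      (fun _ _ => abs_nonneg _) (Finset.mem_univ j)).trans
      (Finset.single_le_sum (f := fun i => ∑ j, |(jacobi e g x)⁻¹ i j|)
        (fun _ _ => Finset.sum_nonneg fun _ _ => abs_nonneg _) (Finset.mem_univ i))
  have hmono : Monotone S := fun a b hab x hx i j => (hx i j).trans (by exact_mod_cast hab)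
  obtain ⟨m₀, hm₀⟩ : ∃ m, 0 < μ (S m) := by
    by_contra! h
    refine hμ (Measure.measure_univ_eq_zero.1 ?_)
    rw [← hcover]
    exact measure_iUnion_null fun m => le_antisymm (h m) zero_le
  -- A chart needs positive measure, so the exhaustion starts at an index where this holds.
  refine ⟨fun m => S (m + m₀), ?_, fun m => ?_, n, fun _ => le_rfl⟩
  · have : ⋃ m, S (m + m₀) = univ := by
      refine eq_univ_of_univ_subset (hcover.symm.subset.trans ?_)
      exact iUnion_mono fun m => hmono (Nat.le_add_right m m₀)
    rw [this, compl_univ, measure_empty]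
  · refine isChart_of_inv_jacobi_bounded hLD hg he (hSm _).nullMeasurableSet
      (hm₀.trans_le (measure_mono (hmono (Nat.le_add_left m₀ m)))) ⟨(m + m₀ : ℕ), ?_⟩
    exact ae_restrict_of_forall_mem (hSm _) fun x hx => hx

omit [TopologicalSpace.SeparableSpace X] in
/-- A basis of derivations can be replaced by one whose Jacobi matrix is scalar. -/
theorem LinIndep.exists_scalar_jacobi {n : ℕ} {g : Fin n → LipFun X} (hg : Generates g)
    {e : Fin n → MetricDerivation μ} (he : LinIndep e) :
    ∃ e' : Fin n → MetricDerivation μ, LinIndep e' ∧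
      ∀ᵐ x ∂μ, ∃ t : ℝ, t ≠ 0 ∧ jacobi e' g x = Matrix.diagonal fun _ => t := by
  have hJ := measurable_adjugate (measurable_jacobi e g)
  -- Dividing the adjugate by `w` bounds its entries by 1; its product with the Jacobi matrix is
  -- then det / w times the identity.
  set w : X → ℝ := fun x => 1 + ∑ k, ∑ l, |(jacobi e g x).adjugate k l| with hw
  have hw0 : ∀ x, 0 < w x := fun x => by positivity
  have hwm : Measurable w := measurable_const.add
    (Finset.measurable_fun_sum _ fun k _ => Finset.measurable_fun_sum _ fun l _ => (hJ k l).abs)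
  have hle : ∀ x i k, |(jacobi e g x).adjugate i k / w x| ≤ 1 := by
    intro x i k
    rw [abs_div, abs_of_pos (hw0 x), div_le_one (hw0 x)]
    have h1 := (Finset.single_le_sum (f := fun k => |(jacobi e g x).adjugate i k|)
      (fun _ _ => abs_nonneg _) (Finset.mem_univ k)).trans
      (Finset.single_le_sum (f := fun i => ∑ k, |(jacobi e g x).adjugate i k|)
        (fun _ _ => Finset.sum_nonneg fun _ _ => abs_nonneg _) (Finset.mem_univ i))
    simp only [hw]
    linarith
  have hmem : ∀ i k, MemLp (fun x => (jacobi e g x).adjugate i k / w x) ∞ μ := fun i k =>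
    memLp_top_of_bound ((hJ i k).div hwm).aestronglyMeasurable 1 (.of_forall fun x => hle x i k)
  set e' : Fin n → MetricDerivation μ := fun i => lincomb (fun k => (hmem i k).toLp) e with he'
  have hdiag : ∀ᵐ x ∂μ, ∃ t : ℝ, t ≠ 0 ∧ jacobi e' g x = Matrix.diagonal fun _ => t := by
    filter_upwards [he.ae_isUnit_det_jacobi hg,
      ae_all_iff.2 fun i => ae_all_iff.2 fun k => (hmem i k).coeFn_toLp,
      ae_all_iff.2 fun i => ae_all_iff.2 fun j =>
        onLip_lincomb (fun k => (hmem i k).toLp) e (g j)] with x h1 h2 h3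
    refine ⟨(jacobi e g x).det / w x, div_ne_zero h1.ne_zero (hw0 x).ne', ?_⟩
    have h4 : jacobi e' g x = (w x)⁻¹ • ((jacobi e g x).adjugate * jacobi e g x) := by
      ext i j
      change (e' i).onLip (g j) x = _
      rw [h3 i j, Matrix.smul_apply, Matrix.mul_apply, smul_eq_mul, Finset.mul_sum]
      refine Finset.sum_congr rfl fun k _ => ?_
      rw [h2 i k, div_eq_inv_mul, mul_assoc]
      rfl
    rw [h4, Matrix.adjugate_mul, smul_smul, Matrix.smul_one_eq_diagonal, div_eq_inv_mul]
  refine ⟨e', fun c hc i => ?_, hdiag⟩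
  refine Lp.ext ?_
  filter_upwards [hdiag, ae_all_iff.2 fun k => hc ((g i).trunc k), Lp.coeFn_zero ℝ ∞ μ]
    with x h1 h2 h3
  obtain ⟨t, ht, hJt⟩ := h1
  -- Testing the relation on g_i isolates `c i x * t`; the height filled in is the one used by
  -- `onLip` at `x`.
  have h4 : ∑ k, c k x * jacobi e' g x k i = 0 := h2 _
  rw [hJt] at h4
  simp only [Matrix.diagonal_apply, mul_ite, mul_zero, Finset.sum_ite_eq', Finset.mem_univ,
    if_true, mul_eq_zero, ht, or_false] at h4
  rw [h3, h4, Pi.zero_apply]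

-- Over the zero measure every L^∞ coefficient is 0, so any tuple is independent. Repeating one
-- derivation `N + 1` times then contradicts the rank; `0 < N` supplies that derivation.
omit [BorelSpace X] [SigmaFinite μ] [TopologicalSpace.SeparableSpace X] in
theorem HasRank.measure_ne_zero {N : ℕ} (hN : 0 < N) (h : HasRank μ N) : μ ≠ 0 := by
  obtain ⟨⟨d, -⟩, hmax⟩ := h
  rintro rfl
  exact hmax (fun _ => d ⟨0, hN⟩) fun c _ i => Lp.ext (by simp [Filter.EventuallyEq])

end Differential

end LipDiff

end

/-! ### Assembly of the theorem. -/

theorem mainTheorem5 {X : Type*} [MetricSpace X] [TopologicalSpace.SeparableSpace X]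
    [MeasurableSpace X] [BorelSpace X] (μ : Measure X) [SigmaFinite μ]
    (N : ℕ) (hN : 0 < N) (hrank : HasRank μ N) (hgen : IsNGenerated X N)
    (hLD : LipDerivationInequality μ) :
    SupportsNondegenerateMDS μ ∧
    ∀ g : Fin N → LipFun X, Generates g →
      -- one and the same coordinate map `g` serves on all charts of an atlas
      (∃ Y : ℕ → Set X, IsAtlas μ Y (fun _ => N) (fun _ => coords g)) ∧
      -- on all of `X`, every Lipschitz function has an a.e. unique measurable differential
      (∀ f : LipFun X, ∃! D : X →ₘ[μ] EuclideanSpace ℝ (Fin N),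
        ∀ᵐ x ∂μ, IsDifferentialAt (coords g) f x (D x)) ∧
      -- the differential is given by any basis of derivations
      (∀ e : Fin N → MetricDerivation μ, LinIndep e →
        (∀ᵐ x ∂μ, (jacobi e g x).det ≠ 0) ∧
        (∀ f : LipFun X, ∀ᵐ x ∂μ, IsDifferentialAt (coords g) f x
          (WithLp.toLp 2 ((jacobi e g x)⁻¹ *ᵥ fun i => (e i).onLip f x))) ∧
        -- a set on which the inverse Jacobi matrix is bounded is a single chart
        (∀ Y : Set X, NullMeasurableSet Y μ → 0 < μ Y →
          (∃ C : ℝ, ∀ᵐ x ∂(μ.restrict Y), ∀ i j, |(jacobi e g x)⁻¹ i j| ≤ C) →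
          IsChart μ Y (coords g))) ∧
      -- there is a basis orthogonal with respect to `g`, for which the formula is diagonal
      (∃ e : Fin N → MetricDerivation μ, LinIndep e ∧
        (∀ᵐ x ∂μ, ∃ t : ℝ, t ≠ 0 ∧ jacobi e g x = Matrix.diagonal fun _ => t) ∧
        ∀ f : LipFun X, ∀ᵐ x ∂μ, IsDifferentialAt (coords g) f x
          (WithLp.toLp 2 fun i => ((e i).onLip (g i) x)⁻¹ * (e i).onLip f x)) := by
  have hμ := hrank.measure_ne_zero hN
  obtain ⟨e₀, he₀⟩ := hrank.1
  refine ⟨?_, fun g hg => ⟨exists_atlas hμ hLD hg he₀, fun f => ?_, fun e he => ⟨?_, ?_, ?_⟩, ?_⟩⟩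
  · obtain ⟨g, hg⟩ := hgen.1
    obtain ⟨Y, hY⟩ := exists_atlas hμ hLD hg he₀
    exact ⟨Y, fun _ => N, fun _ => coords g, hY, 0, hN⟩
  · have hm := (measurable_diff e₀ g f).aestronglyMeasurable (μ := μ)
    refine ⟨AEEqFun.mk _ hm, ?_, fun D hD => ?_⟩
    · filter_upwards [AEEqFun.coeFn_mk _ hm, ae_isDifferentialAt_diff hLD hg he₀ f] with x h1 h2
      rw [h1]; exact h2
    · refine AEEqFun.ext ?_
      filter_upwards [AEEqFun.coeFn_mk _ hm, hD, ae_eq_diff_of_isDifferentialAt hg he₀ f]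
        with x h1 h2 h3
      rw [h1]
      exact h3 _ h2
  · exact (he.ae_isUnit_det_jacobi hg).mono fun x hx => hx.ne_zero
  · exact ae_isDifferentialAt_diff hLD hg he
  · exact fun Y hY hY0 hC => isChart_of_inv_jacobi_bounded hLD hg he hY hY0 hC
  · obtain ⟨e, he, hdiag⟩ := he₀.exists_scalar_jacobi hg
    refine ⟨e, he, hdiag, fun f => ?_⟩
    filter_upwards [hdiag, ae_isDifferentialAt_diff hLD hg he f, he.ae_isUnit_det_jacobi hg]
      with x ⟨t, ht, hJ⟩ h2 h3
    have h4 : jacobi e g x *ᵥ (fun i => ((e i).onLip (g i) x)⁻¹ * (e i).onLip f x) =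
        fun i => (e i).onLip f x := by
      funext i
      have h5 : (e i).onLip (g i) x = t := by
        have := congrFun (congrFun hJ i) i
        rwa [Matrix.diagonal_apply_eq] at this
      rw [hJ, Matrix.mulVec_diagonal, h5, mul_inv_cancel_left₀ ht]
    rwa [diff, ← h4, Matrix.mulVec_mulVec, Matrix.nonsing_inv_mul _ h3, Matrix.one_mulVec] at h2
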